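/- Let $G(k,n)$ be the real Grassmannian of $k$-dimensional linear subspaces of $\mathbb{R}^n$, with $k \le n-k$. Principal vectors $(p_1,q_1),\dots,(p_k,q_k)$ between $\mathbf{L},\mathbf{W}\in G(k,n)$ are defined recursively: $(p_i,q_i)$ maximizes $\langle p,q\rangle$ among the unit vectors $p\in\mathbf{L}$, $q\in\mathbf{W}$ with $p\perp p_1,\dots,p_{i-1}$ and $q\perp q_1,\dots,q_{i-1}$. The principal angles are $\theta_i(\mathbf{L},\mathbf{W})=\arccos\langle p_i,q_i\rangle$, so that $0\le\theta_1\le\dots\le\theta_k\le\frac{\pi}{2}$, and the Grassmann distance is $\delta(\mathbf{L},\mathbf{E})=\big(\sum_{i=1}^k\theta_i(\mathbf{L},\mathbf{E})^2\big)^{1/2}$. Identify the tangent space of $G(k,n)$ at $\mathbf{W}$ with the space of linear maps $A:\mathbf{W}\to\mathbf{W}^\perp$; then the Riemannian exponential map is $\exp_{\mathbf{W}}(A)=e^{M_A}\mathbf{W}$, where $M_A=\begin{pmatrix}0&-A^{\top}\\A&0\end{pmatrix}$ with respect to $\mathbb{R}^n=\mathbf{W}\oplus\mathbf{W}^\perp$.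 Fix $\mathbf{W}\in G(k,n)$ and $1\le s\le k$, and let $$\Omega_s=\{\mathbf{E}\in G(k,n)\mid \dim(\mathbf{E}\cap\mathbf{W})\ge s\}.$$ Write $\delta_{\mathbf{L}}(\mathbf{E})=\delta(\mathbf{L},\mathbf{E})$ and $\theta_i(\mathbf{L})=\theta_i(\mathbf{L},\mathbf{W})$. The generic $\mathbf{L}\in G(k,n)$ (that is, every $\mathbf{L}$ off some real algebraic subset of $G(k,n)$ with dense complement) satisfies $\mathbf{L}\notin\Omega_s$ and $$0<\theta_1(\mathbf{L})<\dots<\theta_k(\mathbf{L})<\tfrac{\pi}{2}.$$ For every $\mathbf{L}$ with $0<\theta_1(\mathbf{L})<\dots<\theta_k(\mathbf{L})<\frac{\pi}{2}$, with any principal vectors $\{p_1,\dots,p_k\}\subset\mathbf{L}$ and $\{q_1,\dots,q_k\}\subset\mathbf{W}$, the restriction of $\delta_{\mathbf{L}}$ to $\Omega_s$ has a unique global minimizer, namely $$\mathbf{E}_m=\mathrm{span}\{q_1,\dots,q_s,p_{s+1},\dots,p_k\},$$ and $$\min\delta_{\mathbf{L}}|_{\Omega_s}=\delta_{\mathbf{L}}(\mathbf{E}_m)=\left(\theta_1(\mathbf{L})^2+\dots+\theta_s(\mathbf{L})^2\right)^{1/2}.$$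 Moreover $\mathbf{E}_m$ is the Eckart–Young point: there is a unique linear map $A_{\mathbf{L}}:\mathbf{W}\to\mathbf{W}^\perp$ with all singular values at most $\frac{\pi}{2}$ and $\exp_{\mathbf{W}}(A_{\mathbf{L}})=\mathbf{L}$; among the linear maps $\mathbf{W}\to\mathbf{W}^\perp$ of rank at most $k-s$ there is a unique one, $B$, that minimizes the Frobenius distance to $A_{\mathbf{L}}$; and $\mathbf{E}_m=\exp_{\mathbf{W}}(B)$. -/

import Mathlib

noncomputable section

namespace NonlinearEckartYoung

/-- Euclidean space `ℝⁿ`. -/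
abbrev Vec (n : ℕ) : Type := EuclideanSpace ℝ (Fin n)

/-- The real Grassmannian `G(k, n)`: the `k`-dimensional linear subspaces of `ℝⁿ`. -/
@[ext]
structure Gr (k n : ℕ) : Type where
  /-- The underlying subspace. -/
  plane : Submodule ℝ (Vec n)
  /-- It has dimension `k`. -/
  finrank_eq : Module.finrank ℝ plane = k

/-- The standard topology of `G(k, n)`, through the embedding that sends a plane to the orthogonal
projection onto it. -/
instance (k n : ℕ) : TopologicalSpace (Gr k n) :=
  TopologicalSpace.induced (fun E => E.plane.starProjection) inferInstance

/-- The entry `(i, j)` of the matrix of the orthogonal projection onto `E`. -/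
def Gr.projEntry {k n : ℕ} (E : Gr k n) (ij : Fin n × Fin n) : ℝ :=
  E.plane.starProjection (EuclideanSpace.single ij.2 1) ij.1

/-- `P` holds for the generic point of `G(k, n)`: it holds off the zero locus of a polynomial (in
the entries of the projection matrix, i.e. off a real algebraic subset of `G(k, n)`), and the
complement of this zero locus is dense. -/
def IsGeneric {k n : ℕ} (P : Gr k n → Prop) : Prop :=
  ∃ F : MvPolynomial (Fin n × Fin n) ℝ,
    Dense {E : Gr k n | MvPolynomial.eval E.projEntry F ≠ 0} ∧
    ∀ E : Gr k n, MvPolynomial.eval E.projEntry F ≠ 0 → P E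

/-- The constraints of the `i`-th optimization problem that defines principal vectors: unit vectors
`x ∈ E` and `y ∈ F`, with `x` orthogonal to `p j` and `y` orthogonal to `q j` for `j < i`. -/
def Feasible {n m : ℕ} (E F : Submodule ℝ (Vec n)) (p q : Fin m → Vec n) (i : ℕ)
    (x y : Vec n) : Prop :=
  (x ∈ E ∧ ‖x‖ = 1 ∧ ∀ j : Fin m, (j : ℕ) < i → inner ℝ x (p j) = 0) ∧
  (y ∈ F ∧ ‖y‖ = 1 ∧ ∀ j : Fin m, (j : ℕ) < i → inner ℝ y (q j) = 0)

/-- `(p 0, q 0), …, (p (m - 1), q (m - 1))` are produced by the recursive algorithm for principal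
vectors between `E` and `F`: each pair maximizes the scalar product among the feasible pairs. -/
def IsPrincipalVectors {n m : ℕ} (E F : Submodule ℝ (Vec n)) (p q : Fin m → Vec n) : Prop :=
  ∀ i : Fin m, Feasible E F p q i (p i) (q i) ∧
    ∀ x y : Vec n, Feasible E F p q i x y → inner ℝ x y ≤ inner ℝ (p i) (q i)

/-- A unit vector of `E` orthogonal to fewer than `dim E` given vectors. -/
theorem exists_unit_orthogonal {n m : ℕ} (E : Submodule ℝ (Vec n))
    (h : m < Module.finrank ℝ E) (p : Fin m → Vec n) :
    ∃ x ∈ E, ‖x‖ = 1 ∧ ∀ j, inner ℝ x (p j) = 0 := by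
  let f : E →ₗ[ℝ] (Fin m → ℝ) :=
    LinearMap.pi fun j => (innerₛₗ ℝ (p j)).comp E.subtype
  have hf : LinearMap.ker f ≠ ⊥ := LinearMap.ker_ne_bot_of_finrank_lt (by simpa using h)
  obtain ⟨v, hv, hv0⟩ := (Submodule.ne_bot_iff _).1 hf
  have hv0' : (v : Vec n) ≠ 0 := by simpa using hv0
  refine ⟨(‖(v : Vec n)‖⁻¹) • (v : Vec n), E.smul_mem _ v.2, ?_, fun j => ?_⟩
  · rw [norm_smul, norm_inv, norm_norm, inv_mul_cancel₀ (norm_ne_zero_iff.2 hv0')]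
  · have h1 : inner ℝ (p j) (v : Vec n) = 0 := congrFun (LinearMap.mem_ker.1 hv) j
    rw [real_inner_smul_left, real_inner_comm, h1, mul_zero]

/-- The unit vectors of `E` orthogonal to given vectors form a compact set. -/
theorem isCompact_unit_orthogonal {n m : ℕ} (E : Submodule ℝ (Vec n)) (p : Fin m → Vec n) :
    IsCompact {x : Vec n | x ∈ E ∧ ‖x‖ = 1 ∧ ∀ j, inner ℝ x (p j) = 0} := by
  refine (isCompact_sphere (0 : Vec n) 1).of_isClosed_subset ?_ fun x hx => by simpa using hx.2.1
  refine (Submodule.closed_of_finiteDimensional E).inter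
    ((isClosed_eq continuous_norm continuous_const).inter ?_)
  have : {x : Vec n | ∀ j, inner ℝ x (p j) = 0} = ⋂ j, {x : Vec n | inner ℝ x (p j) = 0} := by
    ext x; simp
  change IsClosed {x : Vec n | ∀ j, inner ℝ x (p j) = 0}
  rw [this]
  exact isClosed_iInter fun j => isClosed_eq (continuous_id.inner continuous_const) continuous_const

/-- Principal vectors exist. -/
theorem exists_isPrincipalVectors {n : ℕ} (E F : Submodule ℝ (Vec n)) (m : ℕ)
    (hE : m ≤ Module.finrank ℝ E) (hF : m ≤ Module.finrank ℝ F) :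
    ∃ p q : Fin m → Vec n, IsPrincipalVectors E F p q := by
  induction m with
  | zero => exact ⟨Fin.elim0, Fin.elim0, fun i => i.elim0⟩
  | succ m ih =>
    obtain ⟨p, q, hpq⟩ := ih (by omega) (by omega)
    obtain ⟨x₀, hx₀⟩ := exists_unit_orthogonal E (by omega) p
    obtain ⟨y₀, hy₀⟩ := exists_unit_orthogonal F (by omega) q
    obtain ⟨⟨x, y⟩, ⟨hx, hy⟩, hmax⟩ :=
      ((isCompact_unit_orthogonal E p).prod (isCompact_unit_orthogonal F q)).exists_isMaxOn
        ⟨(x₀, y₀), hx₀, hy₀⟩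
        (f := fun z : Vec n × Vec n => inner ℝ z.1 z.2)
        (continuous_fst.inner continuous_snd).continuousOn
    have key : ∀ (i : ℕ), i ≤ m → ∀ a b : Vec n,
        Feasible E F (Fin.snoc p x : Fin (m + 1) → Vec n) (Fin.snoc q y) i a b ↔
          Feasible E F p q i a b := by
      intro i hi a b
      have aux : ∀ (r : Fin m → Vec n) (z c : Vec n),
          (∀ j : Fin (m + 1), (j : ℕ) < i →
            inner ℝ c ((Fin.snoc r z : Fin (m + 1) → Vec n) j) = 0) ↔
          ∀ j : Fin m, (j : ℕ) < i → inner ℝ c (r j) = 0 := by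
        intro r z c
        constructor
        · intro h j hj
          simpa using h j.castSucc (by simpa using hj)
        · intro h j
          refine Fin.lastCases (fun hj => ?_) (fun j hj => ?_) j
          · simp at hj; omega
          · simpa using h j (by simpa using hj)
      simp only [Feasible, aux]
    refine ⟨Fin.snoc p x, Fin.snoc q y, fun i => ?_⟩
    refine Fin.lastCases ?_ (fun i => ?_) i
    · simp only [Fin.snoc_last, Fin.val_last, key m le_rfl]
      refine ⟨⟨⟨hx.1, hx.2.1, fun j _ => hx.2.2 j⟩, hy.1, hy.2.1, fun j _ => hy.2.2 j⟩, ?_⟩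
      intro a b hab
      exact hmax (show (a, b) ∈ _ from
        ⟨⟨hab.1.1, hab.1.2.1, fun j => hab.1.2.2 j j.2⟩,
          hab.2.1, hab.2.2.1, fun j => hab.2.2.2 j j.2⟩)
    · simp only [Fin.snoc_castSucc, Fin.val_castSucc, key i i.2.le]
      exact hpq i

/-- The `i`-th principal angle `θ_{i + 1}` between two `k`-planes, `i = 0, …, k - 1`. -/
def principalAngle {k n : ℕ} (E F : Gr k n) (i : Fin k) : ℝ :=
  let h := exists_isPrincipalVectors E.plane F.plane k E.finrank_eq.ge F.finrank_eq.ge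
  Real.arccos (inner ℝ (h.choose i) (h.choose_spec.choose i))

/-- The Grassmann distance `δ(E, F) = (θ₁² + ⋯ + θ_k²)^{1/2}`. -/
def grassmannDist {k n : ℕ} (E F : Gr k n) : ℝ :=
  √(∑ i, principalAngle E F i ^ 2)

/-- The simple Schubert variety `Ω_s(W) = {E | dim (E ∩ W) ≥ s}`. -/
def schubert {k n : ℕ} (W : Gr k n) (s : ℕ) : Set (Gr k n) :=
  {E | s ≤ Module.finrank ℝ ↥(E.plane ⊓ W.plane)}

/-- The principal angles satisfy `0 < θ₁ < ⋯ < θ_k < π / 2`. -/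
def HasDistinctAngles {k n : ℕ} (L W : Gr k n) : Prop :=
  (∀ i, 0 < principalAngle L W i) ∧ StrictMono (principalAngle L W) ∧
    ∀ i, principalAngle L W i < Real.pi / 2

/-- The tangent space of `G(k, n)` at `W`, as `Hom(W, W^⊥)`; after a choice of orthonormal bases of
`W` and `W^⊥` these are the matrices of size `(n - k) × k`. -/
abbrev Tangent {k n : ℕ} (W : Gr k n) : Type := ↥W.plane →ₗ[ℝ] ↥W.planeᗮ

/-- The skew-symmetric endomorphism `M_A` of `ℝⁿ = W ⊕ W^⊥` with blocks `0, -Aᵀ, A, 0`. -/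
def skew {k n : ℕ} (W : Gr k n) (A : Tangent W) : Vec n →L[ℝ] Vec n :=
  LinearMap.toContinuousLinearMap
    (W.planeᗮ.subtype ∘ₗ A ∘ₗ W.plane.orthogonalProjectionOnto.toLinearMap -
      W.plane.subtype ∘ₗ A.adjoint ∘ₗ W.planeᗮ.orthogonalProjectionOnto.toLinearMap)

/-- The Riemannian exponential map of `G(k, n)` at `W`: `exp_W(A) = e^{M_A} · W`. -/
def grExp {k n : ℕ} (W : Gr k n) (A : Tangent W) : Gr k n where
  plane := W.plane.map (NormedSpace.exp (skew W A) : Vec n →L[ℝ] Vec n).toLinearMap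
  finrank_eq := by
    have hinj : Function.Injective (NormedSpace.exp (skew W A) : Vec n →L[ℝ] Vec n) := by
      let _ : NormedAlgebra ℚ (Vec n →L[ℝ] Vec n) := NormedAlgebra.restrictScalars ℚ ℝ _
      have h := NormedSpace.exp_add_of_commute
        (Commute.neg_left (Commute.refl (skew W A)))
      rw [neg_add_cancel, NormedSpace.exp_zero] at h
      exact Function.LeftInverse.injective
        (g := (NormedSpace.exp (-skew W A) : Vec n →L[ℝ] Vec n))
        fun x => (DFunLike.congr_fun h x).symm
    exact (Submodule.equivMapOfInjective _ hinj W.plane).finrank_eq.symm.trans W.finrank_eq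

/-- The Frobenius norm `tr(AᵀA)^{1/2}`. -/
def frobNorm {k n : ℕ} {W : Gr k n} (A : Tangent W) : ℝ :=
  √(LinearMap.trace ℝ W.plane (A.adjoint ∘ₗ A))

/-- `A` belongs to `R_{π/2}` (all singular values are at most `π / 2`) and `exp_W(A) = L`. -/
def IsGrLog {k n : ℕ} (W L : Gr k n) (A : Tangent W) : Prop :=
  (∀ i, A.singularValues i ≤ Real.pi / 2) ∧ grExp W A = L

/-- `B` is a solution of the Eckart-Young problem for `A` and `r`: it has rank at most `r` and
minimizes the Frobenius distance to `A` among all `C` of rank at most `r`. -/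
def IsBestApprox {k n : ℕ} {W : Gr k n} (A : Tangent W) (r : ℕ) (B : Tangent W) : Prop :=
  Module.finrank ℝ (LinearMap.range B) ≤ r ∧
    ∀ C : Tangent W, Module.finrank ℝ (LinearMap.range C) ≤ r → frobNorm (A - B) ≤ frobNorm (A - C)

/-- `E` is the Eckart-Young point for `L` in `Ω_s(W)`: there is exactly one `A ∈ R_{π/2}` with
`exp_W(A) = L`, this `A` has exactly one best approximation `B` of rank at most `k - s`, and
`E = exp_W(B)`. -/
def IsEckartYoungPoint {k n : ℕ} (W L : Gr k n) (s : ℕ) (E : Gr k n) : Prop :=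
  ∃ A : Tangent W, (IsGrLog W L A ∧ ∀ A', IsGrLog W L A' → A' = A) ∧
    ∃ B : Tangent W, (IsBestApprox A (k - s) B ∧ ∀ B', IsBestApprox A (k - s) B' → B' = B) ∧
      E = grExp W B

end NonlinearEckartYoung

end

/-! Let `E ∈ Ω_s(W)`. A dimension count gives `θ_{k - s + i}(L, E) ≥ θ_i(L, W)` for `i ≤ s`, hence
the lower bound for `δ(L, E)`. If it is attained, then `tr (P_L P_E) = ∑ i, cos² θ_i(L, E)` reaches
the bound of Ky Fan's inequality, whose equality case forces `s` dimensions of `E ∩ W` to be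
`span {q_1, …, q_s}`; the rest of `E` lies in `L`, orthogonally to `p_1, …, p_s`.

The same equality case gives uniqueness in the Eckart–Young theorem. The exponential of `M_A` acts
by plane rotations along a singular value decomposition `A = ∑ i, θ_i • u_i ⊗ q_i`, so `exp_W(A)` is
spanned by the vectors `cos θ_i • q_i + sin θ_i • u_i`, and truncating `A` replaces `p_i` by `q_i`
for `i ≤ s`. Since `exp_W(A)` is the graph of `tan A`, it determines `A` when all `θ_i < π / 2`.

The numbers `cos² θ_i(L, W)` are the eigenvalues of the compression of `P_L` to `W`. They are
distinct and different from `0` and `1` when a certain polynomial in the entries of `P_L` does not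
vanish. -/

namespace NonlinearEckartYoung

open Module (finrank)
open scoped RealInnerProductSpace InnerProduct

section OrthonormalFamilies

variable {ι V : Type*} [NormedAddCommGroup V] [InnerProductSpace ℝ V]

theorem exists_orthonormalOn_mem (N : Submodule ℝ V) [FiniteDimensional ℝ N] {S : Finset ι}
    (hS : S.card ≤ finrank ℝ N) :
    ∃ v : ι → V, (∀ i, v i ∈ N) ∧ Orthonormal ℝ ((S : Set ι).domRestrict v) := by
  classical
  obtain ⟨f⟩ : Nonempty (S ↪ Fin (finrank ℝ N)) :=
    Function.Embedding.nonempty_of_card_le (by simpa using hS)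
  let c := stdOrthonormalBasis ℝ N
  let v : ι → N := fun i => if h : i ∈ S then c (f ⟨i, h⟩) else 0
  have hv : (S : Set ι).domRestrict (fun i => (v i : V)) = fun i => N.subtypeₗᵢ (c (f i)) := by
    ext i
    have hi : (i : ι) ∈ S := i.2
    simp [v, hi]
  refine ⟨fun i => v i, fun i => (v i).2, ?_⟩
  rw [hv]
  exact (c.orthonormal.comp f f.injective).comp_linearIsometry N.subtypeₗᵢ

theorem inner_eq_zero_of_mem_span_image {v : ι → V} (hv : Orthonormal ℝ v) {S : Set ι} {i : ι}
    (hi : i ∉ S) {x : V} (hx : x ∈ Submodule.span ℝ (v '' S)) : ⟪x, v i⟫ = 0 := by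
  have hle : Submodule.span ℝ (v '' S) ≤ (ℝ ∙ v i)ᗮ := Submodule.span_le.2 <| by
    rintro _ ⟨j, hj, rfl⟩
    exact Submodule.mem_orthogonal_singleton_iff_inner_left.2 (hv.2 (ne_of_mem_of_not_mem hj hi))
  exact Submodule.mem_orthogonal_singleton_iff_inner_left.1 (hle hx)

variable [Fintype ι]

theorem exists_orthonormalBasis_coe_eqOn {E : Submodule ℝ V} [FiniteDimensional ℝ E]
    (hE : finrank ℝ E = Fintype.card ι) {S : Set ι} {v : ι → V} (hvE : ∀ i ∈ S, v i ∈ E)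
    (hv : Orthonormal ℝ (S.domRestrict v)) :
    ∃ b : OrthonormalBasis ι ℝ E, ∀ i ∈ S, (b i : V) = v i := by
  classical
  let w : ι → E := fun i => if h : i ∈ S then ⟨v i, hvE i h⟩ else 0
  have coe_w : ∀ i ∈ S, (w i : V) = v i := fun i hi => by simp [w, hi]
  have hw : Orthonormal ℝ (S.domRestrict w) := by
    refine ⟨fun i => ?_, fun i j hij => ?_⟩
    · rw [Set.domRestrict_apply, ← Submodule.norm_coe, coe_w i i.2]
      exact hv.1 i
    · change ⟪w i, w j⟫ = 0
      rw [Submodule.coe_inner, coe_w i i.2, coe_w j j.2]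
      exact hv.2 hij
  obtain ⟨b, hb⟩ := hw.exists_orthonormalBasis_extension_of_card_eq hE
  exact ⟨b, fun i hi => by rw [hb i hi, coe_w i hi]⟩

theorem exists_orthonormalBasis_coe_eq {E : Submodule ℝ V} [FiniteDimensional ℝ E]
    (hE : finrank ℝ E = Fintype.card ι) {v : ι → V} (hvE : ∀ i, v i ∈ E) (hv : Orthonormal ℝ v) :
    ∃ b : OrthonormalBasis ι ℝ E, ∀ i, (b i : V) = v i := by
  obtain ⟨b, hb⟩ := exists_orthonormalBasis_coe_eqOn hE (S := Set.univ) (fun i _ => hvE i)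
    (hv.comp _ Subtype.val_injective)
  exact ⟨b, fun i => hb i (Set.mem_univ i)⟩

theorem exists_orthonormal_norm_smul_eq [FiniteDimensional ℝ V]
    (hV : Fintype.card ι ≤ finrank ℝ V) {v : ι → V} (hv : Pairwise fun i j => ⟪v i, v j⟫ = 0) :
    ∃ u : ι → V, Orthonormal ℝ u ∧ ∀ i, ‖v i‖ • u i = v i := by
  obtain ⟨f⟩ : Nonempty (ι ↪ Fin (finrank ℝ V)) :=
    Function.Embedding.nonempty_of_card_le (by simpa using hV)
  let w : Fin (finrank ℝ V) → V := Function.extend f (fun i => ‖v i‖⁻¹ • v i) 0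
  have w_apply : ∀ i, w (f i) = ‖v i‖⁻¹ • v i := f.injective.extend_apply _ _
  have hw : Orthonormal ℝ ((f '' {i | v i ≠ 0}).domRestrict w) := by
    refine ⟨?_, ?_⟩
    · rintro ⟨_, i, hi, rfl⟩
      simpa [w_apply, norm_smul] using inv_mul_cancel₀ (norm_ne_zero_iff.2 hi)
    · rintro ⟨_, i, hi, rfl⟩ ⟨_, j, hj, rfl⟩ hij
      have hne : i ≠ j := fun h => hij (by simp [h])
      simp [w_apply, real_inner_smul_left, real_inner_smul_right, hv hne]
  obtain ⟨b, hb⟩ := hw.exists_orthonormalBasis_extension_of_card_eq (by simp)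
  refine ⟨b ∘ f, b.orthonormal.comp f f.injective, fun i => ?_⟩
  by_cases hi : v i = 0
  · simp [hi]
  · rw [Function.comp_apply, hb (f i) ⟨i, hi, rfl⟩, w_apply, smul_smul,
      mul_inv_cancel₀ (norm_ne_zero_iff.2 hi), one_smul]

variable {E : Submodule ℝ V} (b : OrthonormalBasis ι ℝ E)

theorem orthonormal_coe : Orthonormal ℝ fun i => (b i : V) :=
  b.orthonormal.comp_linearIsometry E.subtypeₗᵢ

theorem span_range_coe : Submodule.span ℝ (Set.range fun i => (b i : V)) = E := by
  have h : (Set.range fun i => (b i : V)) = E.subtype '' Set.range b := by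
    rw [← Set.range_comp]; rfl
  rw [h, ← Submodule.map_span, ← b.coe_toBasis, b.toBasis.span_eq, Submodule.map_top,
    Submodule.range_subtype]

theorem starProjection_apply_eq_sum [E.HasOrthogonalProjection] (x : V) :
    E.starProjection x = ∑ i, ⟪(b i : V), x⟫ • (b i : V) := by
  simp [b.starProjection_eq_sum_rankOne]

theorem norm_sq_starProjection_eq_sum [E.HasOrthogonalProjection] (x : V) :
    ‖E.starProjection x‖ ^ 2 = ∑ i, ⟪(b i : V), x⟫ ^ 2 := by
  rw [Submodule.starProjection_apply, Submodule.norm_coe, ← b.sum_sq_inner_right]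
  simp

theorem norm_sq_eq_sum_of_mem {x : V} (hx : x ∈ E) : ‖x‖ ^ 2 = ∑ i, ⟪(b i : V), x⟫ ^ 2 :=
  (b.sum_sq_inner_right ⟨x, hx⟩).symm

theorem sum_norm_sq_starProjection_comm {κ : Type*} [Fintype κ] {F : Submodule ℝ V}
    [E.HasOrthogonalProjection] [F.HasOrthogonalProjection] (c : OrthonormalBasis κ ℝ F) :
    ∑ i, ‖F.starProjection (b i)‖ ^ 2 = ∑ j, ‖E.starProjection (c j)‖ ^ 2 := by
  simp_rw [norm_sq_starProjection_eq_sum b, norm_sq_starProjection_eq_sum c]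
  rw [Finset.sum_comm]
  simp_rw [real_inner_comm]

end OrthonormalFamilies

section WeightedSums

variable {ι : Type*} [Fintype ι] {S : Finset ι} {a t : ι → ℝ}

theorem exists_sum_mul_sub_sum_eq [DecidableEq ι] (ha : ∀ i ∈ S, ∀ j ∉ S, a i < a j)
    (ht : ∑ j, t j = S.card) :
    ∃ c, (∀ i ∈ S, a i < c) ∧ (∀ j ∉ S, c < a j) ∧
      ∑ j, a j * t j - ∑ j ∈ S, a j =
        ∑ j ∈ S, (c - a j) * (1 - t j) + ∑ j ∈ Sᶜ, (a j - c) * t j := by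
  obtain ⟨c, hc, hc'⟩ := Order.exists_between_finsets (S.image a) (Sᶜ.image a) (by simpa using ha)
  refine ⟨c, by simpa using hc, by simpa using hc', ?_⟩
  rw [← Finset.sum_add_sum_compl S] at ht
  rw [← Finset.sum_add_sum_compl S]
  simp only [sub_mul, mul_sub, mul_one, Finset.sum_sub_distrib, ← Finset.mul_sum,
    Finset.sum_const, nsmul_eq_mul]
  linear_combination c * ht

theorem sum_le_sum_mul (ha : ∀ i ∈ S, ∀ j ∉ S, a i < a j) (ht0 : ∀ j, 0 ≤ t j)
    (ht1 : ∀ j, t j ≤ 1) (ht : ∑ j, t j = S.card) : ∑ j ∈ S, a j ≤ ∑ j, a j * t j := by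
  classical
  obtain ⟨c, hc, hc', h⟩ := exists_sum_mul_sub_sum_eq ha ht
  rw [← sub_nonneg, h]
  exact add_nonneg
    (Finset.sum_nonneg fun j hj => mul_nonneg (sub_nonneg.2 (hc j hj).le) (sub_nonneg.2 (ht1 j)))
    (Finset.sum_nonneg fun j hj =>
      mul_nonneg (sub_nonneg.2 (hc' j (Finset.mem_compl.1 hj)).le) (ht0 j))

theorem eq_zero_of_sum_mul_le (ha : ∀ i ∈ S, ∀ j ∉ S, a i < a j) (ht0 : ∀ j, 0 ≤ t j)
    (ht1 : ∀ j, t j ≤ 1) (ht : ∑ j, t j = S.card) (hle : ∑ j, a j * t j ≤ ∑ j ∈ S, a j)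
    {j : ι} (hj : j ∉ S) : t j = 0 := by
  classical
  obtain ⟨c, hc, hc', h⟩ := exists_sum_mul_sub_sum_eq ha ht
  have hS : 0 ≤ ∑ j ∈ S, (c - a j) * (1 - t j) :=
    Finset.sum_nonneg fun j hj => mul_nonneg (sub_nonneg.2 (hc j hj).le) (sub_nonneg.2 (ht1 j))
  have hSc : ∀ j ∈ Sᶜ, 0 ≤ (a j - c) * t j := fun j hj =>
    mul_nonneg (sub_nonneg.2 (hc' j (Finset.mem_compl.1 hj)).le) (ht0 j)
  have hzero : ∑ j ∈ Sᶜ, (a j - c) * t j = 0 :=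
    le_antisymm (by linarith) (Finset.sum_nonneg hSc)
  have := (Finset.sum_eq_zero_iff_of_nonneg hSc).1 hzero j (Finset.mem_compl.2 hj)
  exact (mul_eq_zero.1 this).resolve_left (sub_pos.2 (hc' j hj)).ne'

end WeightedSums

section KyFan

variable {ι V : Type*} [Fintype ι] [NormedAddCommGroup V] [InnerProductSpace ℝ V]
  {S : Finset ι} {a : ι → ℝ} (q b : OrthonormalBasis ι ℝ V)

theorem sum_sq_inner_le_one (S : Finset ι) (j : ι) : ∑ i ∈ S, ⟪q j, b i⟫ ^ 2 ≤ 1 :=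
  calc ∑ i ∈ S, ⟪q j, b i⟫ ^ 2 ≤ ∑ i, ⟪q j, b i⟫ ^ 2 :=
        Finset.sum_le_univ_sum_of_nonneg fun i => sq_nonneg _
    _ = 1 := by rw [b.sum_sq_inner_left, q.norm_eq_one, one_pow]

theorem sum_sum_sq_inner_eq_card (S : Finset ι) : ∑ j, ∑ i ∈ S, ⟪q j, b i⟫ ^ 2 = S.card := by
  rw [Finset.sum_comm]
  simp [q.sum_sq_inner_right]

/- The weights `∑ i ∈ S, ⟪q j, b i⟫ ^ 2` lie in `[0, 1]` and add up to `S.card`; a linear function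
of such weights is smallest when they select the smallest coefficients. -/
theorem kyFan_sum_le (ha : ∀ i ∈ S, ∀ j ∉ S, a i < a j) :
    ∑ i ∈ S, a i ≤ ∑ i ∈ S, ∑ j, a j * ⟪q j, b i⟫ ^ 2 := by
  rw [Finset.sum_comm]
  simp only [← Finset.mul_sum]
  exact sum_le_sum_mul ha (fun j => Finset.sum_nonneg fun i _ => sq_nonneg _)
    (sum_sq_inner_le_one q b S) (sum_sum_sq_inner_eq_card q b S)

theorem span_image_eq_of_kyFan_sum_ge (ha : ∀ i ∈ S, ∀ j ∉ S, a i < a j)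
    (hle : ∑ i ∈ S, ∑ j, a j * ⟪q j, b i⟫ ^ 2 ≤ ∑ i ∈ S, a i) :
    Submodule.span ℝ (b '' S) = Submodule.span ℝ (q '' S) := by
  classical
  rw [Finset.sum_comm] at hle
  simp only [← Finset.mul_sum] at hle
  have inner_eq_zero : ∀ i ∈ S, ∀ j ∉ S, ⟪q j, b i⟫ = 0 := fun i hi j hj => by
    have hsum := eq_zero_of_sum_mul_le ha (fun j => Finset.sum_nonneg fun i _ => sq_nonneg _)
      (sum_sq_inner_le_one q b S) (sum_sum_sq_inner_eq_card q b S) hle hj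
    exact pow_eq_zero_iff two_ne_zero |>.1
      ((Finset.sum_eq_zero_iff_of_nonneg fun i _ => sq_nonneg _).1 hsum i hi)
  have finrank_span : ∀ c : OrthonormalBasis ι ℝ V,
      finrank ℝ (Submodule.span ℝ (c '' S)) = S.card := fun c => by
    have hc : LinearIndependent ℝ fun i : S => c i :=
      c.orthonormal.linearIndependent.comp _ Subtype.val_injective
    rw [Set.image_eq_range, ← Fintype.card_coe S]
    exact finrank_span_eq_card hc
  have := q.toBasis.finiteDimensional_of_finite
  refine Submodule.eq_of_le_of_finrank_eq ?_ ((finrank_span b).trans (finrank_span q).symm)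
  rw [Submodule.span_le]
  rintro _ ⟨i, hi, rfl⟩
  rw [← q.sum_repr' (b i)]
  refine Submodule.sum_mem _ fun j _ => ?_
  by_cases hj : j ∈ S
  · exact Submodule.smul_mem _ _ (Submodule.subset_span ⟨j, hj, rfl⟩)
  · simp [inner_eq_zero i hi j hj]

end KyFan

section PrincipalPairs

variable {ι V : Type*} [Fintype ι] [NormedAddCommGroup V] [InnerProductSpace ℝ V]
  {E F : Submodule ℝ V} {p : OrthonormalBasis ι ℝ E} {q : OrthonormalBasis ι ℝ F} {σ : ι → ℝ}

/-- Orthonormal bases `p` of `E` and `q` of `F` whose matrix of scalar products is diagonal, with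
nonnegative entries `σ` (the cosines of the angles between `p i` and `q i`, in any order). -/
structure IsPrincipalPair (p : OrthonormalBasis ι ℝ E) (q : OrthonormalBasis ι ℝ F)
    (σ : ι → ℝ) : Prop where
  inner_self : ∀ i, ⟪(p i : V), (q i : V)⟫ = σ i
  inner_eq_zero : ∀ {i j}, i ≠ j → ⟪(p i : V), (q j : V)⟫ = 0
  nonneg : ∀ i, 0 ≤ σ i

namespace IsPrincipalPair

theorem symm (h : IsPrincipalPair p q σ) : IsPrincipalPair q p σ where
  inner_self i := by rw [real_inner_comm, h.inner_self]
  inner_eq_zero hij := by rw [real_inner_comm, h.inner_eq_zero hij.symm]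
  nonneg := h.nonneg

theorem reindex (h : IsPrincipalPair p q σ) (e : Equiv.Perm ι) :
    IsPrincipalPair (p.reindex e.symm) (q.reindex e.symm) (σ ∘ e) where
  inner_self i := by simp [h.inner_self]
  inner_eq_zero hij := by simp [h.inner_eq_zero (e.injective.ne hij)]
  nonneg i := h.nonneg (e i)

theorem le_one (h : IsPrincipalPair p q σ) (i : ι) : σ i ≤ 1 := by
  simpa [h.inner_self, (orthonormal_coe p).1, (orthonormal_coe q).1] using
    real_inner_le_norm (p i : V) (q i)

theorem starProjection_eq [F.HasOrthogonalProjection] (h : IsPrincipalPair p q σ) (i : ι) :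
    F.starProjection (p i) = σ i • (q i : V) := by
  rw [starProjection_apply_eq_sum q,
    Finset.sum_eq_single i (fun j _ hj => by rw [h.symm.inner_eq_zero hj, zero_smul]) (by simp),
    h.symm.inner_self]

theorem inner_eq_mul [F.HasOrthogonalProjection] (h : IsPrincipalPair p q σ) {y : V} (hy : y ∈ F)
    (i : ι) : ⟪(p i : V), y⟫ = σ i * ⟪(q i : V), y⟫ := by
  rw [← Submodule.starProjection_eq_self_iff.2 hy, ← Submodule.inner_starProjection_left_eq_right,
    h.starProjection_eq, real_inner_smul_left, Submodule.starProjection_eq_self_iff.2 hy]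

theorem norm_sq_starProjection [E.HasOrthogonalProjection] [F.HasOrthogonalProjection]
    (h : IsPrincipalPair p q σ) {y : V} (hy : y ∈ F) :
    ‖E.starProjection y‖ ^ 2 = ∑ i, σ i ^ 2 * ⟪(q i : V), y⟫ ^ 2 := by
  simp_rw [norm_sq_starProjection_eq_sum p, h.inner_eq_mul hy, mul_pow]

theorem disjoint [E.HasOrthogonalProjection] [F.HasOrthogonalProjection]
    (h : IsPrincipalPair p q σ) (hσ : ∀ i, σ i ≠ 1) : Disjoint E F := by
  refine Submodule.disjoint_def.2 fun x hxE hxF => ?_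
  have inner_eq_zero : ∀ i, ⟪(p i : V), x⟫ = 0 := fun i => by
    have sq_mul : σ i ^ 2 * ⟪(p i : V), x⟫ = ⟪(p i : V), x⟫ := by
      rw [sq, mul_assoc, ← h.symm.inner_eq_mul hxE, ← h.inner_eq_mul hxF]
    by_contra hne
    exact hσ i <|
      (pow_eq_one_iff_of_nonneg (h.nonneg i) two_ne_zero).1 ((mul_eq_right₀ hne).1 sq_mul)
  simpa [inner_eq_zero] using norm_sq_eq_sum_of_mem p hxE

theorem disjoint_orthogonal [E.HasOrthogonalProjection] (h : IsPrincipalPair p q σ)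
    (hσ : ∀ i, σ i ≠ 0) : Disjoint E Fᗮ := by
  refine Submodule.disjoint_def.2 fun y hyE hyF => ?_
  have inner_eq_zero : ∀ i, ⟪(p i : V), y⟫ = 0 := fun i =>
    (mul_eq_zero.1 ((h.symm.inner_eq_mul hyE i).symm.trans (hyF _ (q i).2))).resolve_left (hσ i)
  simpa [inner_eq_zero] using norm_sq_eq_sum_of_mem p hyE

section LinearOrder

variable [LinearOrder ι] [E.HasOrthogonalProjection] [F.HasOrthogonalProjection]

theorem sq_le_norm_sq_starProjection (h : IsPrincipalPair p q σ) (hσ : Antitone σ) {y : V}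
    (hy : y ∈ F) (hy1 : ‖y‖ = 1) {i : ι} (hi : ∀ a > i, ⟪(q a : V), y⟫ = 0) :
    σ i ^ 2 ≤ ‖E.starProjection y‖ ^ 2 :=
  calc σ i ^ 2 = ∑ a, σ i ^ 2 * ⟪(q a : V), y⟫ ^ 2 := by
        rw [← Finset.mul_sum, ← norm_sq_eq_sum_of_mem q hy, hy1, one_pow, mul_one]
    _ ≤ ∑ a, σ a ^ 2 * ⟪(q a : V), y⟫ ^ 2 := by
        refine Finset.sum_le_sum fun a _ => ?_
        rcases le_or_gt a i with ha | ha
        · have := hσ ha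
          have := h.nonneg i
          gcongr
        · simp [hi a ha]
    _ = ‖E.starProjection y‖ ^ 2 := (h.norm_sq_starProjection hy).symm

theorem norm_sq_starProjection_le_sq (h : IsPrincipalPair p q σ) (hσ : Antitone σ) {y : V}
    (hy : y ∈ F) (hy1 : ‖y‖ = 1) {i : ι} (hi : ∀ a < i, ⟪(q a : V), y⟫ = 0) :
    ‖E.starProjection y‖ ^ 2 ≤ σ i ^ 2 :=
  calc ‖E.starProjection y‖ ^ 2 = ∑ a, σ a ^ 2 * ⟪(q a : V), y⟫ ^ 2 := h.norm_sq_starProjection hy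
    _ ≤ ∑ a, σ i ^ 2 * ⟪(q a : V), y⟫ ^ 2 := by
        refine Finset.sum_le_sum fun a _ => ?_
        rcases lt_or_ge a i with ha | ha
        · simp [hi a ha]
        · have := hσ ha
          have := h.nonneg a
          gcongr
    _ = σ i ^ 2 := by
        rw [← Finset.mul_sum, ← norm_sq_eq_sum_of_mem q hy, hy1, one_pow, mul_one]

end LinearOrder

end IsPrincipalPair

end PrincipalPairs

section PrincipalAngles

namespace IsPrincipalPair

variable {k n : ℕ} {E F F' : Submodule ℝ (Vec n)} {p p' : OrthonormalBasis (Fin k) ℝ E}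
  {q : OrthonormalBasis (Fin k) ℝ F} {q' : OrthonormalBasis (Fin k) ℝ F'} {σ σ' : Fin k → ℝ}

theorem le_of_le_finrank_inf (h : IsPrincipalPair p q σ) (hσ : Antitone σ)
    (h' : IsPrincipalPair p' q' σ') (hσ' : Antitone σ') {s : ℕ}
    (hs : s ≤ finrank ℝ ↥(F' ⊓ F)) {i j : Fin k} (hij : (j : ℕ) + k ≤ i + s) : σ' i ≤ σ j := by
  let κ := Finset.Iio j ⊕ Finset.Ioi i
  have hcard : Fintype.card κ < finrank ℝ ↥(F' ⊓ F) := by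
    simp only [κ, Fintype.card_sum, Fintype.card_coe, Fin.card_Iio, Fin.card_Ioi]
    omega
  let w : κ → Vec n := Sum.elim (fun a => q a) (fun a => q' a)
  obtain ⟨y, hy, hy1, hyo⟩ :=
    exists_unit_orthogonal (F' ⊓ F) hcard (w ∘ (Fintype.equivFin κ).symm)
  have inner_eq_zero : ∀ c, ⟪w c, y⟫ = 0 := fun c => by
    simpa [real_inner_comm] using hyo (Fintype.equivFin κ c)
  refine le_of_sq_le_sq ?_ (h.nonneg j)
  exact (h'.sq_le_norm_sq_starProjection hσ' hy.1 hy1 fun a ha =>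
      inner_eq_zero (Sum.inr ⟨a, Finset.mem_Ioi.2 ha⟩)).trans
    (h.norm_sq_starProjection_le_sq hσ hy.2 hy1 fun a ha =>
      inner_eq_zero (Sum.inl ⟨a, Finset.mem_Iio.2 ha⟩))

theorem eq_of_antitone {q' : OrthonormalBasis (Fin k) ℝ F} (h : IsPrincipalPair p q σ)
    (hσ : Antitone σ) (h' : IsPrincipalPair p' q' σ') (hσ' : Antitone σ') : σ = σ' := by
  have hk : k ≤ finrank ℝ ↥(F ⊓ F) := by
    rw [inf_idem, Module.finrank_eq_card_basis q.toBasis, Fintype.card_fin]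
  funext i
  exact le_antisymm (h'.le_of_le_finrank_inf hσ' h hσ hk le_rfl)
    (h.le_of_le_finrank_inf hσ h' hσ' hk le_rfl)

end IsPrincipalPair

namespace IsPrincipalVectors

variable {n m : ℕ} {E F : Submodule ℝ (Vec n)} {p q : Fin m → Vec n}

theorem symm (h : IsPrincipalVectors E F p q) : IsPrincipalVectors F E q p := fun i =>
  ⟨(h i).1.symm, fun x y hxy => by
    rw [real_inner_comm y x, real_inner_comm (p i) (q i)]; exact (h i).2 y x hxy.symm⟩

theorem inner_nonneg (h : IsPrincipalVectors E F p q) (i : Fin m) : 0 ≤ ⟪p i, q i⟫ := by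
  obtain ⟨⟨⟨hE, h1, ho⟩, hq⟩, hmax⟩ := h i
  have := hmax (-p i) (q i) ⟨⟨E.neg_mem hE, by rwa [norm_neg],
    fun j hj => by rw [inner_neg_left, ho j hj, neg_zero]⟩, hq⟩
  rw [inner_neg_left] at this
  linarith

theorem antitone (h : IsPrincipalVectors E F p q) : Antitone fun i => ⟪p i, q i⟫ := by
  intro i j hij
  obtain ⟨⟨hpE, hp1, hpo⟩, hqF, hq1, hqo⟩ := (h j).1
  exact (h i).2 _ _ ⟨⟨hpE, hp1, fun a ha => hpo a (ha.trans_le hij)⟩, hqF, hq1,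
    fun a ha => hqo a (ha.trans_le hij)⟩

theorem orthonormal_left (h : IsPrincipalVectors E F p q) : Orthonormal ℝ p := by
  refine ⟨fun i => (h i).1.1.2.1, fun i j hij => ?_⟩
  rcases lt_or_gt_of_ne hij with hlt | hlt
  · rw [real_inner_comm]; exact (h j).1.1.2.2 i hlt
  · exact (h i).1.1.2.2 j hlt

/- Write `a = ⟪p i, q i⟫` and `c = ⟪p j, q i⟫`. The unit vector in the direction `a p i + c p j`
competes with `p i`, and its scalar product with `q i` is `√(a² + c²)`. -/
theorem inner_eq_zero_of_lt (h : IsPrincipalVectors E F p q) {i j : Fin m} (hij : i < j) :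
    ⟪p j, q i⟫ = 0 := by
  obtain ⟨⟨⟨hpi, -, hoi⟩, hq⟩, hmax⟩ := h i
  obtain ⟨⟨⟨hpj, -, hoj⟩, -⟩, -⟩ := h j
  set a := ⟪p i, q i⟫
  set c := ⟪p j, q i⟫
  by_contra hc
  let x := a • p i + c • p j
  have hxq : ⟪x, q i⟫ = a ^ 2 + c ^ 2 := by
    rw [inner_add_left, real_inner_smul_left, real_inner_smul_left]
    ring
  have hxx : ‖x‖ ^ 2 = a ^ 2 + c ^ 2 := by
    have hpp : ⟪p i, p j⟫ = 0 := h.orthonormal_left.2 hij.ne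
    rw [norm_add_sq_real, norm_smul, norm_smul, h.orthonormal_left.1, h.orthonormal_left.1,
      real_inner_smul_left, real_inner_smul_right, hpp, Real.norm_eq_abs, Real.norm_eq_abs]
    simp
  have hc2 : 0 < c ^ 2 := by positivity
  have hx : 0 < ‖x‖ := by
    refine (norm_nonneg x).lt_of_ne fun h0 => ?_
    rw [← h0] at hxx
    linarith [sq_nonneg a]
  have hle : ⟪‖x‖⁻¹ • x, q i⟫ ≤ a := by
    refine hmax _ _ ⟨⟨E.smul_mem _ (E.add_mem (E.smul_mem _ hpi) (E.smul_mem _ hpj)), ?_, ?_⟩, hq⟩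
    · rw [norm_smul, norm_inv, norm_norm, inv_mul_cancel₀ hx.ne']
    · intro l hl
      rw [real_inner_smul_left, inner_add_left, real_inner_smul_left, real_inner_smul_left,
        hoi l hl, hoj l (hl.trans hij)]
      simp
  rw [real_inner_smul_left, hxq, ← hxx, sq, inv_mul_cancel_left₀ hx.ne'] at hle
  nlinarith [h.inner_nonneg i]

theorem exists_isPrincipalPair (h : IsPrincipalVectors E F p q) (hE : finrank ℝ E = m)
    (hF : finrank ℝ F = m) :
    ∃ (b : OrthonormalBasis (Fin m) ℝ E) (c : OrthonormalBasis (Fin m) ℝ F),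
      (∀ i, (b i : Vec n) = p i) ∧ (∀ i, (c i : Vec n) = q i) ∧
        IsPrincipalPair b c fun i => ⟪p i, q i⟫ := by
  obtain ⟨b, hb⟩ := exists_orthonormalBasis_coe_eq (by simpa using hE) (fun i => (h i).1.1.1)
    h.orthonormal_left
  obtain ⟨c, hc⟩ := exists_orthonormalBasis_coe_eq (by simpa using hF) (fun i => (h i).1.2.1)
    h.symm.orthonormal_left
  refine ⟨b, c, hb, hc, ⟨fun i => by rw [hb, hc], fun {i j} hij => ?_, h.inner_nonneg⟩⟩
  rw [hb, hc]
  rcases lt_or_gt_of_ne hij with hlt | hlt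
  · rw [real_inner_comm]; exact h.symm.inner_eq_zero_of_lt hlt
  · exact h.inner_eq_zero_of_lt hlt

end IsPrincipalVectors

variable {k n : ℕ} {E F : Gr k n} {p : OrthonormalBasis (Fin k) ℝ E.plane}
  {q : OrthonormalBasis (Fin k) ℝ F.plane} {σ : Fin k → ℝ}

theorem exists_principalAngle_eq_arccos (E F : Gr k n) :
    ∃ (p : OrthonormalBasis (Fin k) ℝ E.plane) (q : OrthonormalBasis (Fin k) ℝ F.plane)
      (σ : Fin k → ℝ), IsPrincipalPair p q σ ∧ Antitone σ ∧
        ∀ i, principalAngle E F i = Real.arccos (σ i) := by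
  have h := (exists_isPrincipalVectors E.plane F.plane k E.finrank_eq.ge
    F.finrank_eq.ge).choose_spec.choose_spec
  obtain ⟨p, q, -, -, hpq⟩ := h.exists_isPrincipalPair E.finrank_eq F.finrank_eq
  exact ⟨p, q, _, hpq, h.antitone, fun _ => rfl⟩

theorem IsPrincipalPair.principalAngle_eq (h : IsPrincipalPair p q σ) (hσ : Antitone σ)
    (i : Fin k) : principalAngle E F i = Real.arccos (σ i) := by
  obtain ⟨p', q', σ', h', hσ', hangle⟩ := exists_principalAngle_eq_arccos E F
  rw [hangle, h.eq_of_antitone hσ h' hσ']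

theorem principalAngle_nonneg (E F : Gr k n) (i : Fin k) : 0 ≤ principalAngle E F i :=
  Real.arccos_nonneg _

theorem principalAngle_le_pi_div_two (E F : Gr k n) (i : Fin k) :
    principalAngle E F i ≤ Real.pi / 2 := by
  obtain ⟨p, q, σ, h, -, hangle⟩ := exists_principalAngle_eq_arccos E F
  rw [hangle, Real.arccos_le_pi_div_two]
  exact h.nonneg i

theorem principalAngle_mem_Icc (E F : Gr k n) (i : Fin k) :
    principalAngle E F i ∈ Set.Icc 0 Real.pi :=
  ⟨principalAngle_nonneg E F i, Real.arccos_le_pi _⟩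

theorem IsPrincipalVectors.exists_isPrincipalPair_cos {p q : Fin k → Vec n}
    (h : IsPrincipalVectors E.plane F.plane p q) :
    ∃ (b : OrthonormalBasis (Fin k) ℝ E.plane) (c : OrthonormalBasis (Fin k) ℝ F.plane),
      (fun i => (b i : Vec n)) = p ∧ (fun i => (c i : Vec n)) = q ∧
        IsPrincipalPair b c fun i => Real.cos (principalAngle E F i) := by
  obtain ⟨b, c, hb, hc, pair⟩ := h.exists_isPrincipalPair E.finrank_eq F.finrank_eq
  refine ⟨b, c, funext hb, funext hc, ?_⟩
  convert pair using 2 with i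
  rw [pair.principalAngle_eq h.antitone,
    Real.cos_arccos (neg_one_lt_zero.le.trans (pair.nonneg i)) (pair.le_one i)]

theorem exists_isPrincipalPair_cos (E F : Gr k n) :
    ∃ (p : OrthonormalBasis (Fin k) ℝ E.plane) (q : OrthonormalBasis (Fin k) ℝ F.plane),
      IsPrincipalPair p q fun i => Real.cos (principalAngle E F i) := by
  obtain ⟨p, q, h⟩ := exists_isPrincipalVectors E.plane F.plane k E.finrank_eq.ge F.finrank_eq.ge
  obtain ⟨b, c, -, -, pair⟩ := h.exists_isPrincipalPair_cos
  exact ⟨b, c, pair⟩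

theorem monotone_principalAngle (E F : Gr k n) : Monotone (principalAngle E F) := by
  obtain ⟨p, q, σ, -, hσ, hangle⟩ := exists_principalAngle_eq_arccos E F
  intro i j hij
  rw [hangle, hangle]
  exact Real.antitone_arccos (hσ hij)

theorem antitone_cos_principalAngle (E F : Gr k n) :
    Antitone fun i => Real.cos (principalAngle E F i) := fun i j hij =>
  Real.strictAntiOn_cos.antitoneOn (principalAngle_mem_Icc E F i) (principalAngle_mem_Icc E F j)
    (monotone_principalAngle E F hij)

theorem IsPrincipalPair.grassmannDist_eq (h : IsPrincipalPair p q σ) :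
    grassmannDist E F = √(∑ i, Real.arccos (σ i) ^ 2) := by
  let e := Tuple.sort (fun i => -σ i)
  have hanti : Antitone (σ ∘ e) := fun i j hij => by
    simpa using Tuple.monotone_sort (fun i => -σ i) hij
  rw [grassmannDist]
  simp_rw [(h.reindex e).principalAngle_eq hanti]
  congr 1
  exact Equiv.sum_comp e (fun i => Real.arccos (σ i) ^ 2)

end PrincipalAngles

section TraceMaximization

namespace IsPrincipalPair

variable {ι V : Type*} [Fintype ι] [NormedAddCommGroup V] [InnerProductSpace ℝ V]
  {L W E : Submodule ℝ V} {p : OrthonormalBasis ι ℝ L} {q : OrthonormalBasis ι ℝ W} {σ : ι → ℝ}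
  {S : Finset ι}

theorem neg_sq_lt_neg_sq (h : IsPrincipalPair p q σ) (hσ : ∀ i ∈ S, ∀ j ∉ S, σ j < σ i) :
    ∀ i ∈ S, ∀ j ∉ S, -σ i ^ 2 < -σ j ^ 2 := fun i hi j hj =>
  neg_lt_neg (pow_lt_pow_left₀ (hσ i hi j hj) (h.nonneg j) two_ne_zero)

theorem orthonormal_piecewise [DecidableEq ι] (h : IsPrincipalPair p q σ) (S : Finset ι) :
    Orthonormal ℝ fun i => if i ∈ S then (q i : V) else p i := by
  refine ⟨fun i => ?_, fun i j hij => ?_⟩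
  · dsimp only
    split_ifs
    exacts [(orthonormal_coe q).1 i, (orthonormal_coe p).1 i]
  · dsimp only
    split_ifs
    exacts [(orthonormal_coe q).2 hij, h.symm.inner_eq_zero hij, h.inner_eq_zero hij,
      (orthonormal_coe p).2 hij]

theorem piecewise [DecidableEq ι] (h : IsPrincipalPair p q σ) {r : OrthonormalBasis ι ℝ E}
    (hr : ∀ i, (r i : V) = if i ∈ S then (q i : V) else p i) :
    IsPrincipalPair p r fun i => if i ∈ S then σ i else 1 where
  inner_self i := by
    rw [hr]
    split_ifs
    exacts [h.inner_self i, by rw [real_inner_self_eq_norm_sq, (orthonormal_coe p).1, one_pow]]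
  inner_eq_zero {i j} hij := by
    rw [hr]
    split_ifs
    exacts [h.inner_eq_zero hij, (orthonormal_coe p).2 hij]
  nonneg i := by
    split_ifs
    exacts [h.nonneg i, zero_le_one]

variable [FiniteDimensional ℝ V]

theorem sum_norm_sq_starProjection_eq_neg (h : IsPrincipalPair p q σ)
    (w : OrthonormalBasis ι ℝ W) :
    ∑ i ∈ S, ‖L.starProjection (w i)‖ ^ 2 = -∑ i ∈ S, ∑ j, -σ j ^ 2 * ⟪q j, w i⟫ ^ 2 := by
  simp only [neg_mul, Finset.sum_neg_distrib, neg_neg]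
  exact Finset.sum_congr rfl fun i _ => h.norm_sq_starProjection (w i).2

theorem sum_norm_sq_starProjection_le (h : IsPrincipalPair p q σ)
    (hσ : ∀ i ∈ S, ∀ j ∉ S, σ j < σ i) (w : OrthonormalBasis ι ℝ W) :
    ∑ i ∈ S, ‖L.starProjection (w i)‖ ^ 2 ≤ ∑ i ∈ S, σ i ^ 2 := by
  rw [h.sum_norm_sq_starProjection_eq_neg w, neg_le, ← Finset.sum_neg_distrib]
  exact kyFan_sum_le q w (h.neg_sq_lt_neg_sq hσ)

theorem span_image_eq_of_sum_le (h : IsPrincipalPair p q σ)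
    (hσ : ∀ i ∈ S, ∀ j ∉ S, σ j < σ i) {w : OrthonormalBasis ι ℝ W}
    (hle : ∑ i ∈ S, σ i ^ 2 ≤ ∑ i ∈ S, ‖L.starProjection (w i)‖ ^ 2) :
    Submodule.span ℝ ((fun i => (w i : V)) '' S) =
      Submodule.span ℝ ((fun i => (q i : V)) '' S) := by
  rw [h.sum_norm_sq_starProjection_eq_neg w, le_neg, ← Finset.sum_neg_distrib] at hle
  have hspan := congrArg (Submodule.map W.subtype)
    (span_image_eq_of_kyFan_sum_ge q w (h.neg_sq_lt_neg_sq hσ) hle)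
  rwa [Submodule.map_span, Submodule.map_span, Set.image_image, Set.image_image] at hspan

variable [DecidableEq ι]

theorem exists_orthonormalBasis_of_le_sum (h : IsPrincipalPair p q σ)
    (hσ : ∀ i ∈ S, ∀ j ∉ S, σ j < σ i) (hE : finrank ℝ E = Fintype.card ι)
    (hS : S.card ≤ finrank ℝ ↥(E ⊓ W))
    (hle : ∑ i, (if i ∈ S then σ i ^ 2 else 1) ≤ ∑ i, ‖E.starProjection (p i)‖ ^ 2) :
    ∃ b : OrthonormalBasis ι ℝ E, (∀ i ∉ S, (b i : V) ∈ L) ∧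
      Submodule.span ℝ ((fun i => (b i : V)) '' S) =
        Submodule.span ℝ ((fun i => (q i : V)) '' S) := by
  obtain ⟨v, hvN, hv⟩ := exists_orthonormalOn_mem (E ⊓ W) hS
  obtain ⟨b, hb⟩ := exists_orthonormalBasis_coe_eqOn hE (fun i _ => (hvN i).1) hv
  obtain ⟨w, hw⟩ := exists_orthonormalBasis_coe_eqOn (Module.finrank_eq_card_basis q.toBasis)
    (fun i _ => (hvN i).2) hv
  have hwb : ∀ i ∈ S, (w i : V) = b i := fun i hi => (hw i hi).trans (hb i hi).symm
  have norm_sq_le : ∀ i ∈ Sᶜ, ‖L.starProjection (b i)‖ ^ 2 ≤ 1 := fun i _ =>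
    pow_le_one₀ (norm_nonneg _)
      ((L.norm_starProjection_apply_le _).trans ((orthonormal_coe b).1 i).le)
  have hS_le := h.sum_norm_sq_starProjection_le hσ w
  have hSc_le := Finset.sum_le_sum norm_sq_le
  have hle' : ∑ i ∈ S, σ i ^ 2 + ∑ i ∈ Sᶜ, 1 ≤
      ∑ i ∈ S, ‖L.starProjection (w i)‖ ^ 2 + ∑ i ∈ Sᶜ, ‖L.starProjection (b i)‖ ^ 2 := by
    rw [sum_norm_sq_starProjection_comm p b, ← Finset.sum_add_sum_compl S,
      ← Finset.sum_add_sum_compl S (fun i => ‖L.starProjection (b i)‖ ^ 2),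
      Finset.sum_congr rfl fun i (hi : i ∈ S) => if_pos hi,
      Finset.sum_congr rfl fun i hi => if_neg (Finset.mem_compl.1 hi)] at hle
    rwa [Finset.sum_congr rfl fun i hi => congrArg (‖L.starProjection ·‖ ^ 2) (hwb i hi)]
  refine ⟨b, fun i hi => ?_, ?_⟩
  · have heq := (Finset.sum_eq_sum_iff_of_le norm_sq_le).1 (by linarith) i
      (Finset.mem_compl.2 hi)
    rw [Submodule.mem_iff_norm_starProjection, (orthonormal_coe b).1]
    exact (pow_eq_one_iff_of_nonneg (norm_nonneg _) two_ne_zero).1 heq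
  · rw [← h.span_image_eq_of_sum_le hσ (w := w) (by linarith), Set.image_congr hwb]

theorem le_span_range_ite_of_le_sum (h : IsPrincipalPair p q σ)
    (hσ : ∀ i ∈ S, ∀ j ∉ S, σ j < σ i) (hpos : ∀ i ∈ S, 0 < σ i)
    (hE : finrank ℝ E = Fintype.card ι) (hS : S.card ≤ finrank ℝ ↥(E ⊓ W))
    (hle : ∑ i, (if i ∈ S then σ i ^ 2 else 1) ≤ ∑ i, ‖E.starProjection (p i)‖ ^ 2) :
    E ≤ Submodule.span ℝ (Set.range fun i => if i ∈ S then (q i : V) else p i) := by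
  obtain ⟨b, hbL, hspan⟩ := h.exists_orthonormalBasis_of_le_sum hσ hE hS hle
  rw [← span_range_coe b, Submodule.span_le]
  rintro _ ⟨i, rfl⟩
  by_cases hi : i ∈ S
  · have hbi : (b i : V) ∈ Submodule.span ℝ ((fun i => (q i : V)) '' S) :=
      hspan ▸ Submodule.subset_span ⟨i, hi, rfl⟩
    refine Submodule.span_mono ?_ hbi
    rintro _ ⟨j, hj, rfl⟩
    exact ⟨j, if_pos hj⟩
  · have inner_q : ∀ j ∈ S, ⟪(q j : V), (b i : V)⟫ = 0 := fun j hj =>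
      inner_eq_zero_of_mem_span_image (orthonormal_coe b) hi
        (hspan ▸ Submodule.subset_span ⟨j, hj, rfl⟩)
    have inner_p : ∀ j ∈ S, ⟪(p j : V), (b i : V)⟫ = 0 := fun j hj => by
      have := h.symm.inner_eq_mul (hbL i hi) j
      rw [inner_q j hj] at this
      exact (mul_eq_zero.1 this.symm).resolve_left (hpos j hj).ne'
    change (b i : V) ∈ _
    rw [← Submodule.starProjection_eq_self_iff.2 (hbL i hi),
      starProjection_apply_eq_sum p]
    refine Submodule.sum_mem _ fun j _ => ?_
    by_cases hj : j ∈ S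
    · simp [inner_p j hj]
    · exact Submodule.smul_mem _ _ (Submodule.subset_span ⟨j, if_neg hj⟩)

end IsPrincipalPair

end TraceMaximization

section DistanceToSchubert

variable {k n s : ℕ} {L W E Em : Gr k n}

theorem HasDistinctAngles.cos_pos (hL : HasDistinctAngles L W) (i : Fin k) :
    0 < Real.cos (principalAngle L W i) :=
  Real.cos_pos_of_mem_Ioo ⟨by linarith [hL.1 i, Real.pi_pos], hL.2.2 i⟩

theorem HasDistinctAngles.cos_lt_cos (hL : HasDistinctAngles L W) {i j : Fin k} (hij : i < j) :
    Real.cos (principalAngle L W j) < Real.cos (principalAngle L W i) :=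
  Real.strictAntiOn_cos (principalAngle_mem_Icc L W i) (principalAngle_mem_Icc L W j)
    (hL.2.1 hij)

theorem le_of_mem_schubert (hE : E ∈ schubert W s) : s ≤ k :=
  hE.trans ((Submodule.finrank_mono inf_le_left).trans E.finrank_eq.le)

theorem exists_perm_principalAngle_le (hE : E ∈ schubert W s) :
    ∃ e : Equiv.Perm (Fin k), ∀ i : Fin k,
      (if (i : ℕ) < s then principalAngle L W i else 0) ≤ principalAngle L E (e i) := by
  obtain ⟨r, rfl⟩ := Nat.exists_eq_add_of_le (le_of_mem_schubert hE)
  refine ⟨finAddFlip.trans (finCongr (Nat.add_comm r s)), fun i => ?_⟩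
  split_ifs with hi
  · obtain ⟨p, q, h⟩ := exists_isPrincipalPair_cos L W
    obtain ⟨p', q', h'⟩ := exists_isPrincipalPair_cos L E
    rw [← Real.strictAntiOn_cos.le_iff_ge (principalAngle_mem_Icc L E _)
      (principalAngle_mem_Icc L W i)]
    refine h.le_of_le_finrank_inf (antitone_cos_principalAngle L W) h'
      (antitone_cos_principalAngle L E) hE ?_
    simp only [Equiv.trans_apply, finAddFlip_apply_mk_left hi, finCongr_apply, Fin.val_cast]
    omega
  · exact principalAngle_nonneg L E _

theorem sum_cos_sq_eq_of_sum_sq_le (hE : E ∈ schubert W s)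
    (hle : ∑ i, principalAngle L E i ^ 2 ≤
      ∑ i with (i : Fin k).val < s, principalAngle L W i ^ 2) :
    ∑ i, Real.cos (principalAngle L E i) ^ 2 =
      ∑ i : Fin k, if (i : ℕ) < s then Real.cos (principalAngle L W i) ^ 2 else 1 := by
  obtain ⟨e, he⟩ := exists_perm_principalAngle_le (L := L) hE
  set φ : Fin k → ℝ := fun i => if (i : ℕ) < s then principalAngle L W i else 0
  have φ_nonneg : ∀ i, 0 ≤ φ i := fun i => by
    simp only [φ]; split_ifs
    exacts [principalAngle_nonneg L W i, le_rfl]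
  have sq_le : ∀ i ∈ Finset.univ, φ i ^ 2 ≤ principalAngle L E (e i) ^ 2 := fun i _ =>
    pow_le_pow_left₀ (φ_nonneg i) (he i) 2
  have sum_φ : ∑ i, φ i ^ 2 = ∑ i with (i : Fin k).val < s, principalAngle L W i ^ 2 := by
    simp only [φ, ite_pow, Finset.sum_filter, zero_pow two_ne_zero]
  rw [← Equiv.sum_comp e, ← sum_φ] at hle
  rw [← Equiv.sum_comp e]
  refine Finset.sum_congr rfl fun i hi => ?_
  have sq_eq := (Finset.sum_eq_sum_iff_of_le sq_le).1 ((Finset.sum_le_sum sq_le).antisymm hle) i hi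
  rw [← (pow_left_inj₀ (φ_nonneg i) (principalAngle_nonneg L E _) two_ne_zero).1 sq_eq]
  simp only [φ]
  split_ifs <;> simp

theorem sum_norm_sq_starProjection_eq_sum_cos_sq (p : OrthonormalBasis (Fin k) ℝ L.plane) :
    ∑ i, ‖E.plane.starProjection (p i)‖ ^ 2 = ∑ i, Real.cos (principalAngle L E i) ^ 2 := by
  obtain ⟨p', q', h⟩ := exists_isPrincipalPair_cos L E
  rw [sum_norm_sq_starProjection_comm p q']
  refine Finset.sum_congr rfl fun i _ => ?_
  rw [h.symm.starProjection_eq, norm_smul, (orthonormal_coe p').1, mul_one, Real.norm_eq_abs,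
    sq_abs]

namespace IsPrincipalPair

variable {p : OrthonormalBasis (Fin k) ℝ L.plane} {q : OrthonormalBasis (Fin k) ℝ W.plane}

theorem le_span_range_ite_of_sum_sq_le
    (h : IsPrincipalPair p q fun i => Real.cos (principalAngle L W i))
    (hL : HasDistinctAngles L W) (hE : E ∈ schubert W s)
    (hle : ∑ i, principalAngle L E i ^ 2 ≤
      ∑ i with (i : Fin k).val < s, principalAngle L W i ^ 2) :
    E.plane ≤ Submodule.span ℝ
      (Set.range fun i : Fin k => if (i : ℕ) < s then (q i : Vec n) else p i) := by
  have hcard : (Finset.univ.filter fun i : Fin k => (i : ℕ) < s).card ≤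
      finrank ℝ ↥(E.plane ⊓ W.plane) := by
    rw [Fin.card_filter_val_lt, min_eq_right (le_of_mem_schubert hE)]
    exact hE
  have hsum := sum_norm_sq_starProjection_eq_sum_cos_sq (E := E) p
  rw [sum_cos_sq_eq_of_sum_sq_le hE hle] at hsum
  simpa using h.le_span_range_ite_of_le_sum (S := Finset.univ.filter fun i : Fin k => (i : ℕ) < s)
    (fun i hi j hj => hL.cos_lt_cos (by simp at hi hj; omega)) (fun i _ => hL.cos_pos i)
    (by simpa using E.finrank_eq) hcard (by simpa using hsum.ge)

theorem exists_gr_plane_eq_span {σ : Fin k → ℝ} (h : IsPrincipalPair p q σ) (s : ℕ) :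
    ∃ Em : Gr k n, Em.plane = Submodule.span ℝ
      (Set.range fun i : Fin k => if (i : ℕ) < s then (q i : Vec n) else p i) := by
  have ho := h.orthonormal_piecewise (Finset.univ.filter fun i : Fin k => (i : ℕ) < s)
  simp only [Finset.mem_filter_univ] at ho
  exact ⟨⟨Submodule.span ℝ (Set.range _),
    (finrank_span_eq_card ho.linearIndependent).trans (Fintype.card_fin k)⟩, rfl⟩

theorem grassmannDist_eq_of_plane_eq_span
    (h : IsPrincipalPair p q fun i => Real.cos (principalAngle L W i))
    (hEm : Em.plane = Submodule.span ℝ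
      (Set.range fun i : Fin k => if (i : ℕ) < s then (q i : Vec n) else p i)) :
    grassmannDist L Em = √(∑ i with (i : Fin k).val < s, principalAngle L W i ^ 2) := by
  have ho := h.orthonormal_piecewise (Finset.univ.filter fun i : Fin k => (i : ℕ) < s)
  simp only [Finset.mem_filter_univ] at ho
  obtain ⟨r, hr⟩ := exists_orthonormalBasis_coe_eq (by simpa using Em.finrank_eq)
    (fun i => hEm.ge (Submodule.subset_span ⟨i, rfl⟩)) ho
  rw [(h.piecewise (S := Finset.univ.filter fun i : Fin k => (i : ℕ) < s)
    (by simpa using hr)).grassmannDist_eq, Finset.sum_filter]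
  refine congrArg _ (Finset.sum_congr rfl fun i _ => ?_)
  simp only [Finset.mem_filter_univ]
  split_ifs
  · rw [Real.arccos_cos (principalAngle_nonneg L W i) (principalAngle_mem_Icc L W i).2]
  · rw [Real.arccos_one, zero_pow two_ne_zero]

theorem grassmannDist_lt_of_ne
    (h : IsPrincipalPair p q fun i => Real.cos (principalAngle L W i))
    (hL : HasDistinctAngles L W)
    (hEm : Em.plane = Submodule.span ℝ
      (Set.range fun i : Fin k => if (i : ℕ) < s then (q i : Vec n) else p i))
    (hE : E ∈ schubert W s) (hne : E ≠ Em) : grassmannDist L Em < grassmannDist L E := by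
  contrapose! hne
  rw [h.grassmannDist_eq_of_plane_eq_span hEm, grassmannDist,
    Real.sqrt_le_sqrt_iff (Finset.sum_nonneg fun i _ => sq_nonneg _)] at hne
  have hle := hEm ▸ h.le_span_range_ite_of_sum_sq_le hL hE hne
  exact Gr.ext (Submodule.eq_of_le_of_finrank_eq hle (E.finrank_eq.trans Em.finrank_eq.symm))

end IsPrincipalPair

theorem mem_schubert_of_forall_mem (hsk : s ≤ k) {q : OrthonormalBasis (Fin k) ℝ W.plane}
    (hq : ∀ i : Fin k, (i : ℕ) < s → (q i : Vec n) ∈ E.plane) : E ∈ schubert W s := by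
  have hv := (orthonormal_coe q).comp (Fin.castLE hsk) (Fin.castLE_injective hsk)
  have hcard := finrank_span_eq_card hv.linearIndependent
  rw [Fintype.card_fin] at hcard
  refine hcard.ge.trans (Submodule.finrank_mono (Submodule.span_le.2 ?_))
  rintro _ ⟨i, rfl⟩
  exact ⟨hq _ i.2, (q _).2⟩

end DistanceToSchubert

section SingularValueDecomposition

variable {ι E F : Type*} [Fintype ι] [NormedAddCommGroup E] [InnerProductSpace ℝ E]
  [NormedAddCommGroup F] [InnerProductSpace ℝ F]

/-- The linear map `∑ i, τ i • u i ⊗ b i` with the singular value decomposition given by the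
orthonormal basis `b`, the orthonormal family `u` and the singular values `τ`. -/
noncomputable def ofSVD (b : OrthonormalBasis ι ℝ E) (u : ι → F) (τ : ι → ℝ) : E →ₗ[ℝ] F :=
  b.toBasis.constr ℝ fun i => τ i • u i

variable {b b' : OrthonormalBasis ι ℝ E} {u u' : ι → F} {τ τ' : ι → ℝ}

@[simp]
theorem ofSVD_apply_basis (i : ι) : ofSVD b u τ (b i) = τ i • u i := by
  rw [← b.coe_toBasis, ofSVD, Module.Basis.constr_basis]

theorem ofSVD_apply (x : E) : ofSVD b u τ x = ∑ i, (τ i * ⟪b i, x⟫) • u i := by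
  conv_lhs => rw [← b.sum_repr' x]
  simp [smul_smul, mul_comm]

theorem eq_ofSVD {A : E →ₗ[ℝ] F} (h : ∀ i, A (b i) = τ i • u i) : A = ofSVD b u τ :=
  b.toBasis.ext fun i => by simp [h]

theorem norm_sq_ofSVD_apply (hu : Orthonormal ℝ u) (x : E) :
    ‖ofSVD b u τ x‖ ^ 2 = ∑ i, τ i ^ 2 * ⟪b i, x⟫ ^ 2 := by
  rw [ofSVD_apply, ← real_inner_self_eq_norm_sq, hu.inner_sum]
  simp [← sq, mul_pow]

theorem inner_ofSVD_basis_ofSVD (hu : Orthonormal ℝ u) (i : ι) (x : E) :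
    ⟪ofSVD b u τ (b i), ofSVD b u τ x⟫ = τ i ^ 2 * ⟪b i, x⟫ := by
  rw [ofSVD_apply_basis, ofSVD_apply, real_inner_smul_left, hu.inner_right_fintype, sq, mul_assoc]

theorem eq_of_ofSVD_eq (hu : Orthonormal ℝ u) (hu' : Orthonormal ℝ u') (hτ : ∀ i, 0 ≤ τ i)
    (hτ' : ∀ i, 0 ≤ τ' i) (h : ofSVD b u τ = ofSVD b' u' τ') {i j : ι}
    (hij : ⟪b j, b' i⟫ ≠ 0) : τ j = τ' i := by
  have h1 := inner_ofSVD_basis_ofSVD (b := b) (τ := τ) hu j (b' i)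
  have h2 := inner_ofSVD_basis_ofSVD (b := b') (τ := τ') hu' i (b j)
  rw [h, real_inner_comm, h2, real_inner_comm (b j)] at h1
  exact ((pow_left_inj₀ (hτ' i) (hτ j) two_ne_zero).1 (mul_right_cancel₀ hij h1)).symm

theorem ofSVD_comp_eq_ofSVD_comp (hu : Orthonormal ℝ u) (hu' : Orthonormal ℝ u')
    (hτ : ∀ i, 0 ≤ τ i) (hτ' : ∀ i, 0 ≤ τ' i) (h : ofSVD b u τ = ofSVD b' u' τ') {g : ℝ → ℝ}
    (hg : g 0 = 0) : ofSVD b u (g ∘ τ) = ofSVD b' u' (g ∘ τ') := by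
  refine eq_ofSVD fun i => ?_
  have apply_eq : ∀ f : ℝ → ℝ,
      ofSVD b u (f ∘ τ) (b' i) = f (τ' i) • ∑ j, ⟪b j, b' i⟫ • u j := fun f => by
    rw [ofSVD_apply, Finset.smul_sum]
    refine Finset.sum_congr rfl fun j _ => ?_
    rw [smul_smul, Function.comp_apply]
    by_cases hij : ⟪b j, b' i⟫ = 0
    · rw [hij, mul_zero, mul_zero]
    · rw [eq_of_ofSVD_eq hu hu' hτ hτ' h hij]
  have hid := apply_eq id
  rw [Function.id_comp, h, ofSVD_apply_basis, id] at hid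
  rw [apply_eq, Function.comp_apply]
  by_cases h0 : τ' i = 0
  · rw [h0, hg, zero_smul, zero_smul]
  · rw [smul_right_injective F h0 hid]

theorem norm_ofSVD_apply_le (hu : Orthonormal ℝ u) {c : ℝ} (hc : 0 ≤ c)
    (hτ : ∀ i, τ i ∈ Set.Icc 0 c) (x : E) : ‖ofSVD b u τ x‖ ≤ c * ‖x‖ := by
  refine le_of_sq_le_sq ?_ (by positivity)
  rw [norm_sq_ofSVD_apply hu, mul_pow, ← b.sum_sq_norm_inner_right x, Finset.mul_sum]
  refine Finset.sum_le_sum fun i _ => ?_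
  rw [Real.norm_eq_abs, sq_abs]
  exact mul_le_mul_of_nonneg_right (pow_le_pow_left₀ (hτ i).1 (hτ i).2 2) (sq_nonneg _)

variable [FiniteDimensional ℝ E] [FiniteDimensional ℝ F]

theorem adjoint_ofSVD_apply (hu : Orthonormal ℝ u) (i : ι) :
    (ofSVD b u τ).adjoint (u i) = τ i • b i :=
  ext_inner_right ℝ fun x => by
    rw [LinearMap.adjoint_inner_left, ofSVD_apply, hu.inner_right_fintype, real_inner_smul_left]

theorem singularValues_le_of_norm_apply_le {A : E →ₗ[ℝ] F} {c : ℝ} (hc : 0 ≤ c)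
    (hA : ∀ x, ‖A x‖ ≤ c * ‖x‖) (i : ℕ) : A.singularValues i ≤ c := by
  rcases lt_or_ge i (finrank ℝ E) with hi | hi
  · obtain ⟨x, hx⟩ :=
      (A.hasEigenvalue_adjoint_comp_self_sq_singularValues hi).exists_hasEigenvector
    have norm_sq_eq : ‖A x‖ ^ 2 = (A.singularValues i * ‖x‖) ^ 2 := by
      have happly : A.adjoint (A x) = A.singularValues i ^ 2 • x := hx.apply_eq_smul
      rw [← real_inner_self_eq_norm_sq, ← LinearMap.adjoint_inner_right, happly,
        real_inner_smul_right, real_inner_self_eq_norm_sq, mul_pow]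
    have norm_eq := (pow_left_inj₀ (norm_nonneg _)
      (mul_nonneg (A.singularValues_nonneg i) (norm_nonneg x)) two_ne_zero).1 norm_sq_eq
    exact le_of_mul_le_mul_right (norm_eq.symm.trans_le (hA x)) (norm_pos_iff.2 hx.2)
  · rwa [A.singularValues_of_finrank_le hi]

theorem exists_eq_ofSVD {k : ℕ} (hk : finrank ℝ E = k) (hEF : k ≤ finrank ℝ F) (A : E →ₗ[ℝ] F) :
    ∃ (b : OrthonormalBasis (Fin k) ℝ E) (u : Fin k → F),
      Orthonormal ℝ u ∧ A = ofSVD b u fun i => A.singularValues i := by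
  let b := A.isSymmetric_adjoint_comp_self.eigenvectorBasis hk
  have adjoint_apply : ∀ i, A.adjoint (A (b i)) = A.singularValues i ^ 2 • b i := fun i => by
    rw [A.sq_singularValues_fin hk i]
    exact A.isSymmetric_adjoint_comp_self.apply_eigenvectorBasis hk i
  have inner_eq : ∀ i j, ⟪A (b i), A (b j)⟫ = A.singularValues j ^ 2 * ⟪b i, b j⟫ := fun i j => by
    rw [← LinearMap.adjoint_inner_right, adjoint_apply, real_inner_smul_right]
  have norm_eq : ∀ i, ‖A (b i)‖ = A.singularValues i := fun i => by
    refine (pow_left_inj₀ (norm_nonneg _) (A.singularValues_nonneg i) two_ne_zero).1 ?_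
    rw [← real_inner_self_eq_norm_sq, inner_eq, real_inner_self_eq_norm_sq, b.orthonormal.1,
      one_pow, mul_one]
  obtain ⟨u, hu, hAu⟩ := exists_orthonormal_norm_smul_eq (v := fun i => A (b i))
    (by simpa using hEF) fun i j hij =>
      (inner_eq i j).trans (by rw [b.orthonormal.2 hij, mul_zero])
  exact ⟨b, u, hu, eq_ofSVD fun i => by rw [← norm_eq, hAu]⟩

end SingularValueDecomposition

section EckartYoung

variable {ι E F : Type*} [Fintype ι] [NormedAddCommGroup E] [InnerProductSpace ℝ E]
  [NormedAddCommGroup F] [InnerProductSpace ℝ F]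

theorem finrank_range_le_card_of_apply_eq_zero (b : OrthonormalBasis ι ℝ E) {S : Finset ι}
    {B : E →ₗ[ℝ] F} (hB : ∀ i ∉ S, B (b i) = 0) : finrank ℝ (LinearMap.range B) ≤ S.card := by
  classical
  have hle : LinearMap.range B ≤ Submodule.span ℝ (S.image fun i => B (b i) : Finset F) := by
    rw [LinearMap.range_eq_map, ← b.toBasis.span_eq, Submodule.map_span, Submodule.span_le]
    rintro _ ⟨_, ⟨i, rfl⟩, rfl⟩
    rw [b.coe_toBasis]
    by_cases hi : i ∈ S
    · exact Submodule.subset_span (Finset.mem_coe.2 (Finset.mem_image_of_mem _ hi))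
    · rw [hB i hi]
      exact Submodule.zero_mem _
  exact (Submodule.finrank_mono hle).trans
    ((finrank_span_finset_le_card _).trans Finset.card_image_le)

theorem exists_orthonormalBasis_apply_eq_zero [FiniteDimensional ℝ E]
    (b : OrthonormalBasis ι ℝ E) {S : Finset ι} {C : E →ₗ[ℝ] F}
    (hC : S.card ≤ finrank ℝ (LinearMap.ker C)) :
    ∃ c : OrthonormalBasis ι ℝ E, ∀ i ∈ S, C (c i) = 0 := by
  obtain ⟨v, hvC, hv⟩ := exists_orthonormalOn_mem (LinearMap.ker C) hC
  obtain ⟨c, hc⟩ :=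
    hv.exists_orthonormalBasis_extension_of_card_eq (Module.finrank_eq_card_basis b.toBasis)
  exact ⟨c, fun i hi => by rw [hc i hi]; exact hvC i⟩

variable {b : OrthonormalBasis ι ℝ E} {u : ι → F} {τ : ι → ℝ} {S : Finset ι} {C : E →ₗ[ℝ] F}

theorem sum_sq_le_sum_norm_sq_ofSVD_apply (hu : Orthonormal ℝ u)
    (hτ : ∀ i ∈ S, ∀ j ∉ S, τ i ^ 2 < τ j ^ 2) (c : OrthonormalBasis ι ℝ E) :
    ∑ i ∈ S, τ i ^ 2 ≤ ∑ i ∈ S, ‖ofSVD b u τ (c i)‖ ^ 2 := by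
  simp only [norm_sq_ofSVD_apply hu]
  exact kyFan_sum_le b c hτ

theorem sum_norm_sq_sub_apply_eq [DecidableEq ι] {A C : E →ₗ[ℝ] F} {c : OrthonormalBasis ι ℝ E}
    (hc : ∀ i ∈ S, C (c i) = 0) :
    ∑ i, ‖(A - C) (c i)‖ ^ 2 = ∑ i ∈ S, ‖A (c i)‖ ^ 2 + ∑ i ∈ Sᶜ, ‖(A - C) (c i)‖ ^ 2 := by
  rw [← Finset.sum_add_sum_compl S]
  exact congrArg (· + _) (Finset.sum_congr rfl fun i hi => by
    rw [LinearMap.sub_apply, hc i hi, sub_zero])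

theorem eq_ofSVD_of_span_image_eq [DecidableEq ι] {c : OrthonormalBasis ι ℝ E}
    (hspan : Submodule.span ℝ (c '' S) = Submodule.span ℝ (b '' S))
    (hc : ∀ i ∈ S, C (c i) = 0) (hc' : ∀ i ∉ S, C (c i) = ofSVD b u τ (c i)) :
    C = ofSVD b u fun i => if i ∈ S then 0 else τ i := by
  refine eq_ofSVD fun j => ?_
  split_ifs with hj
  · have hle : Submodule.span ℝ (c '' S) ≤ LinearMap.ker C := Submodule.span_le.2 <| by
      rintro _ ⟨i, hi, rfl⟩
      exact hc i hi
    rw [zero_smul]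
    exact hle (hspan ▸ Submodule.subset_span ⟨j, hj, rfl⟩)
  · rw [← ofSVD_apply_basis (b := b), ← c.sum_repr' (b j), map_sum, map_sum]
    refine Finset.sum_congr rfl fun i _ => ?_
    by_cases hi : i ∈ S
    · rw [inner_eq_zero_of_mem_span_image b.orthonormal hj
        (hspan ▸ Submodule.subset_span ⟨i, hi, rfl⟩), zero_smul, map_zero, map_zero]
    · rw [map_smul, map_smul, hc' i hi]

theorem eq_of_sum_norm_sq_sub_le [DecidableEq ι] (hu : Orthonormal ℝ u)
    (hτ : ∀ i ∈ S, ∀ j ∉ S, τ i ^ 2 < τ j ^ 2) {c : OrthonormalBasis ι ℝ E}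
    (hc : ∀ i ∈ S, C (c i) = 0)
    (hle : ∑ i, ‖(ofSVD b u τ - C) (c i)‖ ^ 2 ≤ ∑ i ∈ S, τ i ^ 2) :
    C = ofSVD b u fun i => if i ∈ S then 0 else τ i := by
  rw [sum_norm_sq_sub_apply_eq hc] at hle
  have hS := sum_sq_le_sum_norm_sq_ofSVD_apply (b := b) hu hτ c
  have hSc : 0 ≤ ∑ i ∈ Sᶜ, ‖(ofSVD b u τ - C) (c i)‖ ^ 2 :=
    Finset.sum_nonneg fun i _ => sq_nonneg _
  refine eq_ofSVD_of_span_image_eq (c := c) ?_ hc fun i hi => ?_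
  · refine span_image_eq_of_kyFan_sum_ge b c hτ ?_
    simp only [← norm_sq_ofSVD_apply hu]
    linarith
  · have hzero := (Finset.sum_eq_zero_iff_of_nonneg fun i _ => sq_nonneg _).1
      (hSc.antisymm' (by linarith)) i (Finset.mem_compl.2 hi)
    rw [sq_eq_zero_iff, norm_eq_zero, LinearMap.sub_apply, sub_eq_zero] at hzero
    exact hzero.symm

variable [FiniteDimensional ℝ E] [FiniteDimensional ℝ F]

theorem trace_adjoint_comp_self (A : E →ₗ[ℝ] F) (b : OrthonormalBasis ι ℝ E) :
    LinearMap.trace ℝ E (A.adjoint ∘ₗ A) = ∑ i, ‖A (b i)‖ ^ 2 := by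
  rw [LinearMap.trace_eq_sum_inner _ b]
  exact Finset.sum_congr rfl fun i _ => by
    rw [LinearMap.comp_apply, LinearMap.adjoint_inner_right, real_inner_self_eq_norm_sq]

theorem sum_sq_le_trace_adjoint_comp_self_sub (hu : Orthonormal ℝ u)
    (hτ : ∀ i ∈ S, ∀ j ∉ S, τ i ^ 2 < τ j ^ 2) (hC : S.card ≤ finrank ℝ (LinearMap.ker C)) :
    ∑ i ∈ S, τ i ^ 2 ≤
      LinearMap.trace ℝ E ((ofSVD b u τ - C).adjoint ∘ₗ (ofSVD b u τ - C)) := by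
  classical
  obtain ⟨c, hc⟩ := exists_orthonormalBasis_apply_eq_zero b hC
  rw [trace_adjoint_comp_self _ c, sum_norm_sq_sub_apply_eq hc]
  exact (sum_sq_le_sum_norm_sq_ofSVD_apply hu hτ c).trans
    (le_add_of_nonneg_right (Finset.sum_nonneg fun i _ => sq_nonneg _))

theorem eq_of_trace_adjoint_comp_self_sub_le [DecidableEq ι] (hu : Orthonormal ℝ u)
    (hτ : ∀ i ∈ S, ∀ j ∉ S, τ i ^ 2 < τ j ^ 2) (hC : S.card ≤ finrank ℝ (LinearMap.ker C))
    (hle : LinearMap.trace ℝ E ((ofSVD b u τ - C).adjoint ∘ₗ (ofSVD b u τ - C)) ≤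
      ∑ i ∈ S, τ i ^ 2) :
    C = ofSVD b u fun i => if i ∈ S then 0 else τ i := by
  obtain ⟨c, hc⟩ := exists_orthonormalBasis_apply_eq_zero b hC
  rw [trace_adjoint_comp_self _ c] at hle
  exact eq_of_sum_norm_sq_sub_le hu hτ hc hle

theorem trace_adjoint_comp_self_ofSVD_sub [DecidableEq ι] (hu : Orthonormal ℝ u)
    (hC : C = ofSVD b u fun i => if i ∈ S then 0 else τ i) :
    LinearMap.trace ℝ E ((ofSVD b u τ - C).adjoint ∘ₗ (ofSVD b u τ - C)) = ∑ i ∈ S, τ i ^ 2 := by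
  have apply_basis : ∀ i, (ofSVD b u τ - C) (b i) = if i ∈ S then τ i • u i else 0 := fun i => by
    rw [LinearMap.sub_apply, hC, ofSVD_apply_basis, ofSVD_apply_basis]
    split_ifs <;> simp
  rw [trace_adjoint_comp_self _ b, ← Finset.sum_subset S.subset_univ]
  · exact Finset.sum_congr rfl fun i hi => by
      rw [apply_basis, if_pos hi, norm_smul, hu.1, mul_one, Real.norm_eq_abs, sq_abs]
  · exact fun i _ hi => by rw [apply_basis, if_neg hi, norm_zero, zero_pow two_ne_zero]

end EckartYoung

section BestApproximation

variable {k n s : ℕ} {W : Gr k n} {b : OrthonormalBasis (Fin k) ℝ W.plane}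
  {u : Fin k → W.planeᗮ} {τ : Fin k → ℝ}

theorem isBestApprox_ofSVD_unique (hu : Orthonormal ℝ u) (h0 : ∀ i, 0 ≤ τ i) (hτ : StrictMono τ)
    (hsk : s ≤ k) {B : Tangent W} (hB : B = ofSVD b u fun i => if (i : ℕ) < s then 0 else τ i) :
    IsBestApprox (ofSVD b u τ) (k - s) B ∧
      ∀ C, IsBestApprox (ofSVD b u τ) (k - s) C → C = B := by
  let S : Finset (Fin k) := Finset.univ.filter fun i : Fin k => (i : ℕ) < s
  have B_eq : B = ofSVD b u fun i => if i ∈ S then 0 else τ i := by simp [hB, S]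
  have card_S : S.card = s := by rw [Fin.card_filter_val_lt, min_eq_right hsk]
  have sq_lt : ∀ i ∈ S, ∀ j ∉ S, τ i ^ 2 < τ j ^ 2 := fun i hi j hj =>
    pow_lt_pow_left₀ (hτ (by simp [S] at hi hj; omega)) (h0 i) two_ne_zero
  have card_le_ker : ∀ {C : Tangent W}, finrank ℝ (LinearMap.range C) ≤ k - s →
      S.card ≤ finrank ℝ (LinearMap.ker C) := fun {C} hC => by
    have := C.finrank_range_add_finrank_ker
    rw [W.finrank_eq] at this
    omega
  have rank_B : finrank ℝ (LinearMap.range B) ≤ k - s := by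
    have card_compl : Sᶜ.card = k - s := by rw [Finset.card_compl, Fintype.card_fin, card_S]
    rw [← card_compl]
    refine finrank_range_le_card_of_apply_eq_zero b fun i hi => ?_
    rw [B_eq, ofSVD_apply_basis, if_pos (by simpa using hi), zero_smul]
  have trace_B := trace_adjoint_comp_self_ofSVD_sub hu B_eq
  refine ⟨⟨rank_B, fun C hC => Real.sqrt_le_sqrt ?_⟩, fun C hC => ?_⟩
  · rw [trace_B]
    exact sum_sq_le_trace_adjoint_comp_self_sub hu sq_lt (card_le_ker hC)
  · rw [B_eq]
    refine eq_of_trace_adjoint_comp_self_sub_le hu sq_lt (card_le_ker hC.1) ?_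
    have := hC.2 B rank_B
    rw [frobNorm, frobNorm, trace_B,
      Real.sqrt_le_sqrt_iff (Finset.sum_nonneg fun i _ => sq_nonneg _)] at this
    exact this

end BestApproximation

section Exponential

variable {V 𝔸 : Type*} [NormedAddCommGroup V] [NormedSpace ℝ V] [CompleteSpace V] [NormedRing 𝔸]
  [NormedAlgebra ℝ 𝔸] [CompleteSpace 𝔸]

theorem exp_apply_of_semiconj {M : V →L[ℝ] V} {a : 𝔸} {φ : 𝔸 →L[ℝ] V}
    (h : ∀ z, M (φ z) = φ (a * z)) (z : 𝔸) :
    (NormedSpace.exp M : V →L[ℝ] V) (φ z) = φ (NormedSpace.exp a * z) := by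
  let _ : NormedAlgebra ℚ (V →L[ℝ] V) := NormedAlgebra.restrictScalars ℚ ℝ _
  let _ : NormedAlgebra ℚ 𝔸 := NormedAlgebra.restrictScalars ℚ ℝ _
  have pow_apply : ∀ m : ℕ, (M ^ m) (φ z) = φ (a ^ m * z) := fun m => by
    induction m with
    | zero => simp
    | succ m ih => rw [pow_succ', pow_succ', mul_assoc, ← h, ← ih, mul_apply_eq_comp]
  have hM := (NormedSpace.exp_series_hasSum_exp' (𝕂 := ℝ) M).mapL
    (ContinuousLinearMap.apply ℝ V (φ z))
  have ha := ((NormedSpace.exp_series_hasSum_exp' (𝕂 := ℝ) a).mul_right z).mapL φ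
  refine hM.unique ?_
  simpa only [ContinuousLinearMap.apply_apply, smul_apply, pow_apply,
    smul_mul_assoc, map_smul] using ha

end Exponential

section GrassmannExponential

variable {k n : ℕ} {W : Gr k n}

theorem skew_apply_left (A : Tangent W) (x : W.plane) : skew W A x = A x := by
  have hx : W.planeᗮ.orthogonalProjectionOnto (x : Vec n) = 0 :=
    Submodule.orthogonalProjectionOnto_orthogonal_apply_eq_zero x.2
  simp [skew, hx]

theorem skew_apply_right (A : Tangent W) (y : W.planeᗮ) :
    skew W A y = -(A.adjoint y : Vec n) := by
  have hy : W.plane.orthogonalProjectionOnto (y : Vec n) = 0 :=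
    Submodule.orthogonalProjectionOnto_apply_of_mem_orthogonal y.2
  simp [skew, hy]

theorem exp_skew_apply {A : Tangent W} {x : W.plane} {y : W.planeᗮ} {θ : ℝ} (hx : A x = θ • y)
    (hy : A.adjoint y = θ • x) :
    (NormedSpace.exp (skew W A) : Vec n →L[ℝ] Vec n) x =
      Real.cos θ • (x : Vec n) + Real.sin θ • (y : Vec n) := by
  -- Under `1 ↦ x`, `i ↦ y` the restriction of `M_A` becomes multiplication by `θ i` on `ℂ`.
  let φ : ℂ →L[ℝ] Vec n := Complex.reCLM.smulRight (x : Vec n) + Complex.imCLM.smulRight (y : Vec n)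
  have φ_apply : ∀ z, φ z = z.re • (x : Vec n) + z.im • (y : Vec n) := fun z => rfl
  have semiconj : ∀ z, skew W A (φ z) = φ (θ * Complex.I * z) := fun z => by
    rw [φ_apply, φ_apply, map_add, map_smul, map_smul, skew_apply_left, skew_apply_right, hx, hy]
    simp only [Submodule.coe_smul, Complex.mul_re, Complex.mul_im, Complex.ofReal_re,
      Complex.ofReal_im, Complex.I_re, Complex.I_im]
    module
  simpa [φ_apply, ← Complex.exp_eq_exp_ℂ, Complex.exp_ofReal_mul_I_re,
    Complex.exp_ofReal_mul_I_im] using exp_apply_of_semiconj semiconj 1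

variable {b : OrthonormalBasis (Fin k) ℝ W.plane} {u : Fin k → W.planeᗮ} {τ : Fin k → ℝ}

theorem grExp_ofSVD_plane (hu : Orthonormal ℝ u) :
    (grExp W (ofSVD b u τ)).plane = Submodule.span ℝ (Set.range fun i =>
      Real.cos (τ i) • (b i : Vec n) + Real.sin (τ i) • (u i : Vec n)) := by
  let e := (NormedSpace.exp (skew W (ofSVD b u τ)) : Vec n →L[ℝ] Vec n).toLinearMap
  have plane_eq : (grExp W (ofSVD b u τ)).plane =
      (Submodule.span ℝ (Set.range fun i => (b i : Vec n))).map e := by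
    rw [span_range_coe b]
    rfl
  have exp_apply : ∀ i, e (b i) = Real.cos (τ i) • (b i : Vec n) + Real.sin (τ i) • (u i : Vec n) :=
    fun i => exp_skew_apply (ofSVD_apply_basis i) (adjoint_ofSVD_apply hu i)
  rw [plane_eq, Submodule.map_span, ← Set.range_comp]
  exact congrArg (fun v => Submodule.span ℝ (Set.range v)) (funext exp_apply)

theorem inner_add_smul_add_smul {x x' : W.plane} {y y' : W.planeᗮ} (α β α' β' : ℝ) :
    ⟪α • (x : Vec n) + β • (y : Vec n), α' • (x' : Vec n) + β' • (y' : Vec n)⟫ =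
      α * α' * ⟪x, x'⟫ + β * β' * ⟪y, y'⟫ := by
  simp only [inner_add_left, inner_add_right, real_inner_smul_left, real_inner_smul_right,
    y'.2 _ x.2, (real_inner_comm _ _).trans (y.2 _ x'.2), Submodule.coe_inner]
  ring

theorem exists_orthonormalBasis_grExp_ofSVD (hu : Orthonormal ℝ u) :
    ∃ p : OrthonormalBasis (Fin k) ℝ (grExp W (ofSVD b u τ)).plane, ∀ i,
      (p i : Vec n) = Real.cos (τ i) • (b i : Vec n) + Real.sin (τ i) • (u i : Vec n) := by
  refine exists_orthonormalBasis_coe_eq (by rw [Gr.finrank_eq, Fintype.card_fin])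
    (fun i => by rw [grExp_ofSVD_plane hu]; exact Submodule.subset_span ⟨i, rfl⟩)
    (orthonormal_iff_ite.2 fun i j => ?_)
  rw [inner_add_smul_add_smul, orthonormal_iff_ite.1 b.orthonormal, orthonormal_iff_ite.1 hu]
  split_ifs with hij
  · rw [hij]
    linarith [Real.sin_sq_add_cos_sq (τ j)]
  · simp

theorem exists_isPrincipalPair_grExp_ofSVD (hu : Orthonormal ℝ u)
    (hτ : ∀ i, 0 ≤ Real.cos (τ i)) :
    ∃ p : OrthonormalBasis (Fin k) ℝ (grExp W (ofSVD b u τ)).plane,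
      IsPrincipalPair p b fun i => Real.cos (τ i) := by
  obtain ⟨p, hp⟩ := exists_orthonormalBasis_grExp_ofSVD (b := b) (τ := τ) hu
  have inner_eq : ∀ i j, ⟪(p i : Vec n), (b j : Vec n)⟫ = if i = j then Real.cos (τ i) else 0 :=
    fun i j => by
      have := inner_add_smul_add_smul (x := b i) (x' := b j) (y := u i) (y' := u j)
        (Real.cos (τ i)) (Real.sin (τ i)) 1 0
      simpa [hp, orthonormal_iff_ite.1 b.orthonormal] using this
  exact ⟨p, fun i => by rw [inner_eq, if_pos rfl], fun hij => by rw [inner_eq, if_neg hij], hτ⟩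

end GrassmannExponential

section NormalForm

variable {k n : ℕ} {L W : Gr k n} {p : OrthonormalBasis (Fin k) ℝ L.plane}
  {b b' : OrthonormalBasis (Fin k) ℝ W.plane} {u u' : Fin k → W.planeᗮ} {τ τ' θ : Fin k → ℝ}

theorem disjoint_grExp_ofSVD_orthogonal (hu : Orthonormal ℝ u)
    (hτ : ∀ i, 0 < Real.cos (τ i)) : Disjoint (grExp W (ofSVD b u τ)).plane W.planeᗮ := by
  obtain ⟨p, h⟩ := exists_isPrincipalPair_grExp_ofSVD (b := b) hu fun i => (hτ i).le
  exact h.disjoint_orthogonal fun i => (hτ i).ne'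

theorem add_ofSVD_tan_mem_grExp_ofSVD (hu : Orthonormal ℝ u) (hτ : ∀ i, Real.cos (τ i) ≠ 0)
    (x : W.plane) :
    (x : Vec n) + ofSVD b u (Real.tan ∘ τ) x ∈ (grExp W (ofSVD b u τ)).plane := by
  have eq_sum : (x : Vec n) + ofSVD b u (Real.tan ∘ τ) x = ∑ i, (⟪b i, x⟫ / Real.cos (τ i)) •
      (Real.cos (τ i) • (b i : Vec n) + Real.sin (τ i) • (u i : Vec n)) := by
    have x_eq_sum : (x : Vec n) = ∑ i, ⟪b i, x⟫ • (b i : Vec n) := by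
      conv_lhs => rw [← b.sum_repr' x]
      simp only [Submodule.coe_sum, Submodule.coe_smul]
    conv_lhs => rw [x_eq_sum, ofSVD_apply, Submodule.coe_sum, ← Finset.sum_add_distrib]
    refine Finset.sum_congr rfl fun i _ => ?_
    rw [smul_add, smul_smul, smul_smul, div_mul_cancel₀ _ (hτ i), Submodule.coe_smul,
      Function.comp_apply, Real.tan_eq_sin_div_cos, div_mul_comm]
  rw [eq_sum, grExp_ofSVD_plane hu]
  exact Submodule.sum_mem _ fun i _ =>
    Submodule.smul_mem _ _ (Submodule.subset_span ⟨i, rfl⟩)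

theorem lt_pi_div_two_of_disjoint_orthogonal (hu : Orthonormal ℝ u)
    (hL : Disjoint (grExp W (ofSVD b u τ)).plane W.planeᗮ) {i : Fin k}
    (hτ : τ i ≤ Real.pi / 2) : τ i < Real.pi / 2 := by
  refine hτ.lt_of_ne fun h => hu.ne_zero i (Subtype.ext ?_)
  refine Submodule.disjoint_def.1 hL _ ?_ (u i).2
  rw [grExp_ofSVD_plane hu]
  exact Submodule.subset_span ⟨i, by simp [h]⟩

theorem ofSVD_tan_eq_of_grExp_eq (hu : Orthonormal ℝ u) (hu' : Orthonormal ℝ u')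
    (hτ : ∀ i, 0 < Real.cos (τ i)) (hτ' : ∀ i, 0 < Real.cos (τ' i))
    (h : grExp W (ofSVD b u τ) = grExp W (ofSVD b' u' τ')) :
    ofSVD b u (Real.tan ∘ τ) = ofSVD b' u' (Real.tan ∘ τ') := by
  refine LinearMap.ext fun x => sub_eq_zero.1 (Subtype.ext ?_)
  have mem := add_ofSVD_tan_mem_grExp_ofSVD (b := b) hu (fun i => (hτ i).ne') x
  have mem' := add_ofSVD_tan_mem_grExp_ofSVD (b := b') hu' (fun i => (hτ' i).ne') x
  rw [← h] at mem'
  have sub_mem := Submodule.sub_mem _ mem mem'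
  rw [add_sub_add_left_eq_sub, ← Submodule.coe_sub] at sub_mem
  exact Submodule.disjoint_def.1 (disjoint_grExp_ofSVD_orthogonal hu hτ) _ sub_mem
    (Subtype.coe_prop _)

theorem ofSVD_eq_of_grExp_eq (hu : Orthonormal ℝ u) (hu' : Orthonormal ℝ u')
    (hτ : ∀ i, τ i ∈ Set.Ico 0 (Real.pi / 2)) (hτ' : ∀ i, τ' i ∈ Set.Icc 0 (Real.pi / 2))
    (h : grExp W (ofSVD b u τ) = grExp W (ofSVD b' u' τ')) :
    ofSVD b u τ = ofSVD b' u' τ' := by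
  have pi_pos := Real.pi_pos
  have cos_pos : ∀ {t}, t ∈ Set.Ico 0 (Real.pi / 2) → 0 < Real.cos t := fun ht =>
    Real.cos_pos_of_mem_Ioo ⟨by linarith [ht.1], ht.2⟩
  have arctan_tan : ∀ {σ : Fin k → ℝ}, (∀ i, σ i ∈ Set.Ico 0 (Real.pi / 2)) →
      Real.arctan ∘ Real.tan ∘ σ = σ := fun hσ =>
    funext fun i => Real.arctan_tan (by linarith [(hσ i).1]) (hσ i).2
  have tan_nonneg : ∀ {σ : Fin k → ℝ}, (∀ i, σ i ∈ Set.Ico 0 (Real.pi / 2)) →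
      ∀ i, 0 ≤ (Real.tan ∘ σ) i := fun hσ i =>
    Real.tan_nonneg_of_nonneg_of_le_pi_div_two (hσ i).1 (hσ i).2.le
  have disjoint := disjoint_grExp_ofSVD_orthogonal (b := b) hu fun i => cos_pos (hτ i)
  replace hτ' : ∀ i, τ' i ∈ Set.Ico 0 (Real.pi / 2) := fun i =>
    ⟨(hτ' i).1, lt_pi_div_two_of_disjoint_orthogonal hu' (h ▸ disjoint) (hτ' i).2⟩
  have tan_eq := ofSVD_tan_eq_of_grExp_eq hu hu' (fun i => cos_pos (hτ i))
    (fun i => cos_pos (hτ' i)) h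
  have := ofSVD_comp_eq_ofSVD_comp hu hu' (tan_nonneg hτ) (tan_nonneg hτ') tan_eq Real.arctan_zero
  rwa [arctan_tan hτ, arctan_tan hτ'] at this

theorem finrank_orthogonal_plane (W : Gr k n) : k + finrank ℝ W.planeᗮ = n := by
  have := W.plane.finrank_add_finrank_orthogonal
  rwa [W.finrank_eq, finrank_euclideanSpace_fin] at this

theorem IsPrincipalPair.exists_orthonormal_eq_cos_add_sin (hkn : k + k ≤ n)
    (h : IsPrincipalPair p b fun i => Real.cos (θ i)) (hθ : ∀ i, θ i ∈ Set.Icc 0 Real.pi) :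
    ∃ u : Fin k → W.planeᗮ, Orthonormal ℝ u ∧
      ∀ i, (p i : Vec n) = Real.cos (θ i) • (b i : Vec n) + Real.sin (θ i) • (u i : Vec n) := by
  let v : Fin k → W.planeᗮ := fun i => ⟨p i - Real.cos (θ i) • (b i : Vec n), by
    rw [← h.starProjection_eq]
    exact Submodule.sub_starProjection_mem_orthogonal _⟩
  have p_eq : ∀ i, (p i : Vec n) = Real.cos (θ i) • (b i : Vec n) + (1 : ℝ) • (v i : Vec n) :=
    fun i => by simp [v]
  have inner_p : ∀ i j, ⟪p i, p j⟫ = Real.cos (θ i) * Real.cos (θ j) * ⟪b i, b j⟫ + ⟪v i, v j⟫ :=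
    fun i j => by
      rw [Submodule.coe_inner, p_eq, p_eq, inner_add_smul_add_smul, one_mul, one_mul]
  have inner_v : Pairwise fun i j => ⟪v i, v j⟫ = 0 := fun i j hij => by
    simpa [p.orthonormal.2 hij, b.orthonormal.2 hij, eq_comm] using inner_p i j
  have norm_v : ∀ i, ‖v i‖ = Real.sin (θ i) := fun i => by
    have := inner_p i i
    simp only [real_inner_self_eq_norm_sq, p.orthonormal.1, b.orthonormal.1] at this
    refine (pow_left_inj₀ (norm_nonneg _) (Real.sin_nonneg_of_mem_Icc (hθ i)) two_ne_zero).1 ?_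
    linarith [Real.sin_sq_add_cos_sq (θ i)]
  obtain ⟨u, hu, hvu⟩ := exists_orthonormal_norm_smul_eq
    (by have := finrank_orthogonal_plane W; rw [Fintype.card_fin]; omega) inner_v
  refine ⟨u, hu, fun i => ?_⟩
  have coe_hvu : ‖v i‖ • (u i : Vec n) = v i := congrArg Subtype.val (hvu i)
  rw [p_eq, one_smul, ← norm_v, coe_hvu]

end NormalForm

section EckartYoungPoint

variable {k n s : ℕ} {L W Em : Gr k n} {p : OrthonormalBasis (Fin k) ℝ L.plane}
  {b : OrthonormalBasis (Fin k) ℝ W.plane} {u : Fin k → W.planeᗮ} {τ θ : Fin k → ℝ}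

theorem isGrLog_ofSVD (hu : Orthonormal ℝ u) (hτ : ∀ i, τ i ∈ Set.Icc 0 (Real.pi / 2)) :
    IsGrLog W (grExp W (ofSVD b u τ)) (ofSVD b u τ) :=
  ⟨singularValues_le_of_norm_apply_le Real.pi_div_two_pos.le
    (norm_ofSVD_apply_le hu Real.pi_div_two_pos.le hτ), rfl⟩

theorem IsGrLog.eq_ofSVD (hkn : k + k ≤ n) (hu : Orthonormal ℝ u)
    (hτ : ∀ i, τ i ∈ Set.Ico 0 (Real.pi / 2)) {A : Tangent W}
    (hA : IsGrLog W (grExp W (ofSVD b u τ)) A) : A = ofSVD b u τ := by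
  have finrank_orthogonal := finrank_orthogonal_plane W
  obtain ⟨b', u', hu', A_eq⟩ := exists_eq_ofSVD W.finrank_eq (by omega) A
  rw [A_eq]
  exact (ofSVD_eq_of_grExp_eq hu hu' hτ (fun i => ⟨A.singularValues_nonneg i, hA.1 i⟩)
    (by rw [← A_eq, hA.2])).symm

theorem IsPrincipalPair.exists_eq_grExp_ofSVD (hkn : k + k ≤ n)
    (h : IsPrincipalPair p b fun i => Real.cos (θ i)) (hθ : ∀ i, θ i ∈ Set.Icc 0 Real.pi) :
    ∃ u : Fin k → W.planeᗮ, Orthonormal ℝ u ∧ L = grExp W (ofSVD b u θ) ∧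
      ∀ i, (p i : Vec n) = Real.cos (θ i) • (b i : Vec n) + Real.sin (θ i) • (u i : Vec n) := by
  obtain ⟨u, hu, hp⟩ := h.exists_orthonormal_eq_cos_add_sin hkn hθ
  refine ⟨u, hu, Gr.ext ?_, hp⟩
  rw [grExp_ofSVD_plane hu, ← span_range_coe p]
  simp only [hp]

theorem IsPrincipalPair.isEckartYoungPoint_of_plane_eq_span (hkn : k + k ≤ n) (hsk : s ≤ k)
    (h : IsPrincipalPair p b fun i => Real.cos (principalAngle L W i)) (hL : HasDistinctAngles L W)
    (hEm : Em.plane = Submodule.span ℝ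
      (Set.range fun i : Fin k => if (i : ℕ) < s then (b i : Vec n) else p i)) :
    IsEckartYoungPoint W L s Em := by
  obtain ⟨hpos, hmono, hlt⟩ := hL
  obtain ⟨u, hu, L_eq, hp⟩ := h.exists_eq_grExp_ofSVD hkn (principalAngle_mem_Icc L W)
  have log := isGrLog_ofSVD (b := b) hu fun i => ⟨(hpos i).le, (hlt i).le⟩
  have log_unique := fun A => IsGrLog.eq_ofSVD (b := b) (A := A) hkn hu
    fun i => ⟨(hpos i).le, hlt i⟩
  rw [← L_eq] at log log_unique
  refine ⟨_, ⟨log, log_unique⟩, _,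
    isBestApprox_ofSVD_unique hu (fun i => (hpos i).le) hmono hsk rfl, Gr.ext ?_⟩
  rw [hEm, grExp_ofSVD_plane hu]
  congr 2
  funext i
  split_ifs
  · simp
  · exact hp i

end EckartYoungPoint

section GenericityPolynomial

open Polynomial (X C)

variable {ι R S K : Type*} [Fintype ι] [DecidableEq ι] [CommRing R] [CommRing S] [Field K]
  [CharZero K]

/-- A polynomial in the entries of a matrix over a field of characteristic zero that vanishes
exactly when `0`, `1` or a multiple root is among the roots of the characteristic polynomial; the
last factor is its discriminant up to sign, with the sizes fixed so as to commute with ring maps. -/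
noncomputable def spectrumObstruction (M : Matrix ι ι R) : R :=
  M.charpoly.eval 0 * M.charpoly.eval 1 *
    M.charpoly.resultant M.charpoly.derivative (Fintype.card ι) (Fintype.card ι - 1)

theorem map_spectrumObstruction (f : R →+* S) (M : Matrix ι ι R) :
    f (spectrumObstruction M) = spectrumObstruction (M.map f) := by
  rw [spectrumObstruction, spectrumObstruction, Matrix.charpoly_map, Polynomial.derivative_map,
    Polynomial.resultant_map_map, map_mul, map_mul, ← Polynomial.eval_map_apply,
    ← Polynomial.eval_map_apply, map_zero, map_one]

theorem spectrumObstruction_ne_zero_iff {M : Matrix ι ι K} {d : ι → K}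
    (hM : M.charpoly = ∏ i, (X - C (d i))) : spectrumObstruction M ≠ 0 ↔
      (∀ i, d i ≠ 0) ∧ (∀ i, d i ≠ 1) ∧ Function.Injective d := by
  have resultant_ne_zero_iff :
      M.charpoly.resultant M.charpoly.derivative (Fintype.card ι) (Fintype.card ι - 1) ≠ 0 ↔
        Function.Injective d := by
    have := (Polynomial.isUnit_resultant_iff_isCoprime (g := M.charpoly.derivative)
      M.charpoly_monic).trans (Polynomial.separable_def _).symm
    rwa [Polynomial.natDegree_derivative, M.charpoly_natDegree_eq_dim, isUnit_iff_ne_zero,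
      hM, Polynomial.separable_prod_X_sub_C_iff, ← hM] at this
  have eval_ne_zero_iff : ∀ x, M.charpoly.eval x ≠ 0 ↔ ∀ i, d i ≠ x := fun x => by
    simp [hM, Polynomial.eval_prod, Finset.prod_eq_zero_iff, sub_eq_zero, eq_comm (a := x)]
  rw [spectrumObstruction, mul_ne_zero_iff, mul_ne_zero_iff, resultant_ne_zero_iff,
    eval_ne_zero_iff, eval_ne_zero_iff, and_assoc]

end GenericityPolynomial

section ProjectionGram

variable {ι : Type*} [Fintype ι] [DecidableEq ι] {k n : ℕ}

theorem Gr.starProjection_apply (E : Gr k n) (x : Vec n) (a : Fin n) :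
    E.plane.starProjection x a = ∑ b, E.projEntry (a, b) * x b := by
  have x_eq_sum : x = ∑ b, x b • EuclideanSpace.single b (1 : ℝ) := by
    ext a
    simp [Pi.single_apply]
  conv_lhs => rw [x_eq_sum]
  simp [Gr.projEntry, mul_comm]

/-- The matrix of the scalar products `⟪w i, P (w j)⟫`, for `P` the orthogonal projection onto
`E`. -/
noncomputable def projGram (w : ι → Vec n) (E : Gr k n) : Matrix ι ι ℝ :=
  Matrix.of fun i j => ⟪w i, E.plane.starProjection (w j)⟫

theorem exists_eval_projEntry_eq_spectrumObstruction (w : ι → Vec n) :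
    ∃ F : MvPolynomial (Fin n × Fin n) ℝ, ∀ E : Gr k n,
      MvPolynomial.eval E.projEntry F = spectrumObstruction (projGram w E) := by
  refine ⟨spectrumObstruction (Matrix.of fun i j => ∑ a, ∑ b,
    MvPolynomial.C (w i a * w j b) * MvPolynomial.X (a, b)), fun E => ?_⟩
  rw [map_spectrumObstruction]
  congr 1
  ext i j
  simp only [Matrix.map_apply, Matrix.of_apply, map_sum, map_mul, MvPolynomial.eval_C,
    MvPolynomial.eval_X, projGram, PiLp.inner_apply, E.starProjection_apply, RCLike.inner_apply,
    conj_trivial, Finset.sum_mul]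
  exact Finset.sum_congr rfl fun a _ => Finset.sum_congr rfl fun b _ => by ring

theorem IsPrincipalPair.charpoly_projGram {E W : Gr k n} {p : OrthonormalBasis ι ℝ E.plane}
    {q : OrthonormalBasis ι ℝ W.plane} {σ : ι → ℝ} (h : IsPrincipalPair p q σ)
    (w : OrthonormalBasis ι ℝ W.plane) :
    (projGram (fun i => (w i : Vec n)) E).charpoly =
      ∏ i, (Polynomial.X - Polynomial.C (σ i ^ 2)) := by
  let T : W.plane →ₗ[ℝ] W.plane := W.plane.orthogonalProjectionOnto.toLinearMap ∘ₗ
    E.plane.starProjection.toLinearMap ∘ₗ W.plane.subtype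
  have toMatrix_T : ∀ c : OrthonormalBasis ι ℝ W.plane,
      LinearMap.toMatrix c.toBasis c.toBasis T = projGram (fun i => (c i : Vec n)) E := fun c => by
    ext i j
    simp [LinearMap.toMatrix_apply, OrthonormalBasis.repr_apply_apply, projGram, T]
  have projGram_q : projGram (fun i => (q i : Vec n)) E = Matrix.diagonal fun i => σ i ^ 2 := by
    ext i j
    rw [projGram, Matrix.of_apply, h.symm.starProjection_eq, real_inner_smul_right,
      Matrix.diagonal_apply]
    split_ifs with hij
    · rw [hij, h.symm.inner_self, sq]
    · rw [h.symm.inner_eq_zero hij, mul_zero]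
  rw [← toMatrix_T, LinearMap.charpoly_toMatrix, ← LinearMap.charpoly_toMatrix T q.toBasis,
    toMatrix_T, projGram_q, Matrix.charpoly_diagonal]

end ProjectionGram

section Generic

variable {k n s : ℕ} {L W : Gr k n}

theorem notMem_schubert_of_hasDistinctAngles (hs : 1 ≤ s) (h : HasDistinctAngles L W) :
    L ∉ schubert W s := fun hL => by
  obtain ⟨p, q, hpq⟩ := exists_isPrincipalPair_cos L W
  have disjoint := hpq.disjoint fun i hi => (h.1 i).ne' <|
    Real.injOn_cos (principalAngle_mem_Icc L W i) ⟨le_rfl, Real.pi_pos.le⟩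
      (hi.trans Real.cos_zero.symm)
  have : s ≤ finrank ℝ ↥(L.plane ⊓ W.plane) := hL
  rw [disjoint.eq_bot, finrank_bot] at this
  omega

theorem hasDistinctAngles_iff : HasDistinctAngles L W ↔
    (∀ i, Real.cos (principalAngle L W i) ≠ 0) ∧ (∀ i, Real.cos (principalAngle L W i) ≠ 1) ∧
      Function.Injective fun i => Real.cos (principalAngle L W i) := by
  have mem := principalAngle_mem_Icc L W
  refine ⟨fun h => ⟨fun i => (h.cos_pos i).ne', fun i hi => (h.1 i).ne' ?_, ?_⟩,
    fun ⟨h0, h1, hinj⟩ => ⟨fun i => (mem i).1.lt_of_ne fun h => h1 i ?_,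
      (monotone_principalAngle L W).strictMono_of_injective fun i j hij =>
        hinj (by simp only [hij]),
      fun i => (principalAngle_le_pi_div_two L W i).lt_of_ne fun h => h0 i ?_⟩⟩
  · exact Real.injOn_cos (mem i) ⟨le_rfl, Real.pi_pos.le⟩ (hi.trans Real.cos_zero.symm)
  · exact fun i j hij => h.2.1.injective (Real.injOn_cos (mem i) (mem j) hij)
  · rw [← h, Real.cos_zero]
  · rw [h, Real.cos_pi_div_two]

theorem spectrumObstruction_projGram_ne_zero_iff (w : OrthonormalBasis (Fin k) ℝ W.plane) :
    spectrumObstruction (projGram (fun i => (w i : Vec n)) L) ≠ 0 ↔ HasDistinctAngles L W := by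
  obtain ⟨p, q, h⟩ := exists_isPrincipalPair_cos L W
  rw [spectrumObstruction_ne_zero_iff (h.charpoly_projGram w), hasDistinctAngles_iff]
  refine and_congr (forall_congr' fun i => pow_ne_zero_iff two_ne_zero)
    (and_congr (forall_congr' fun i => (pow_eq_one_iff_of_nonneg (h.nonneg i) two_ne_zero).not) ?_)
  exact forall₂_congr fun i j =>
    imp_congr_left (pow_left_inj₀ (h.nonneg i) (h.nonneg j) two_ne_zero)

theorem hasDistinctAngles_grExp_ofSVD {b : OrthonormalBasis (Fin k) ℝ W.plane}
    {u : Fin k → W.planeᗮ} (hu : Orthonormal ℝ u) {τ : Fin k → ℝ} (hτ : StrictMono τ)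
    (hmem : ∀ i, τ i ∈ Set.Ioo 0 (Real.pi / 2)) :
    HasDistinctAngles (grExp W (ofSVD b u τ)) W := by
  have mem_Icc : ∀ i, τ i ∈ Set.Icc 0 Real.pi := fun i =>
    ⟨(hmem i).1.le, by linarith [(hmem i).2, Real.pi_pos]⟩
  obtain ⟨p, h⟩ := exists_isPrincipalPair_grExp_ofSVD (b := b) (τ := τ) hu fun i =>
    Real.cos_nonneg_of_mem_Icc ⟨by linarith [(hmem i).1, Real.pi_pos], (hmem i).2.le⟩
  have angle_eq : principalAngle (grExp W (ofSVD b u τ)) W = τ := funext fun i => by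
    rw [h.principalAngle_eq (fun i j hij => Real.strictAntiOn_cos.antitoneOn (mem_Icc i) (mem_Icc j)
      (hτ.monotone hij)), Real.arccos_cos (mem_Icc i).1 (mem_Icc i).2]
  rw [HasDistinctAngles, angle_eq]
  exact ⟨fun i => (hmem i).1, hτ, fun i => (hmem i).2⟩

theorem continuous_grExp_ofSVD (b : OrthonormalBasis (Fin k) ℝ W.plane) {u : Fin k → W.planeᗮ}
    (hu : Orthonormal ℝ u) : Continuous fun τ : Fin k → ℝ => grExp W (ofSVD b u τ) := by
  let v : (Fin k → ℝ) → Fin k → Vec n := fun τ i =>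
    Real.cos (τ i) • (b i : Vec n) + Real.sin (τ i) • (u i : Vec n)
  have starProjection_eq : ∀ τ, (grExp W (ofSVD b u τ)).plane.starProjection =
      ∑ i, (innerSL ℝ (v τ i)).smulRight (v τ i) := fun τ => by
    obtain ⟨p, hp⟩ := exists_orthonormalBasis_grExp_ofSVD (b := b) (τ := τ) hu
    ext1 x
    simp only [starProjection_apply_eq_sum p, hp, v, sum_apply,
      ContinuousLinearMap.smulRight_apply, innerSL_apply_apply]
  have continuous_v : ∀ i, Continuous fun τ => v τ i := fun i => by fun_prop
  refine continuous_induced_rng.2 ?_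
  simp only [Function.comp_def, starProjection_eq]
  exact continuous_finsetSum _ fun i _ =>
    ((ContinuousLinearMap.smulRightL ℝ (Vec n) (Vec n)).continuous.comp
      ((innerSL ℝ).continuous.comp (continuous_v i))).clm_apply (continuous_v i)

theorem mem_closure_strictMono_Ioo {θ : Fin k → ℝ} (hθ : Monotone θ) {c : ℝ} (hc : 0 < c)
    (hmem : ∀ i, θ i ∈ Set.Icc 0 c) :
    θ ∈ closure {τ : Fin k → ℝ | StrictMono τ ∧ ∀ i, τ i ∈ Set.Ioo 0 c} := by
  let φ : Fin k → ℝ := fun i => c * ((i + 1) / (k + 1))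
  have strictMono_φ : StrictMono φ := fun i j hij => by
    have : (i : ℝ) < j := mod_cast hij
    simp only [φ]
    gcongr
  have φ_mem : ∀ i, φ i ∈ Set.Ioo 0 c := fun i => by
    have : (i : ℝ) < k := mod_cast i.2
    exact ⟨by positivity, mul_lt_of_lt_one_right hc ((div_lt_one (by positivity)).2 (by linarith))⟩
  have tendsto :
      Filter.Tendsto (fun t : ℝ => (1 - t) • θ + t • φ) (nhdsWithin 0 (Set.Ioi 0)) (nhds θ) :=
    (Continuous.tendsto' (by fun_prop) _ _ (by simp)).mono_left nhdsWithin_le_nhds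
  refine mem_closure_of_tendsto tendsto ?_
  filter_upwards [Ioo_mem_nhdsGT (zero_lt_one (α := ℝ))] with t ⟨t_pos, t_lt_one⟩
  refine ⟨fun i j hij => add_lt_add_of_le_of_lt ?_ ?_, fun i => ?_⟩
  · exact mul_le_mul_of_nonneg_left (hθ hij.le) (sub_nonneg.2 t_lt_one.le)
  · exact mul_lt_mul_of_pos_left (strictMono_φ hij) t_pos
  · rw [← interior_Icc] at φ_mem ⊢
    exact (convex_Icc 0 c).combo_self_interior_mem_interior (hmem i) (φ_mem i)
      (sub_nonneg.2 t_lt_one.le) t_pos (sub_add_cancel 1 t)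

theorem dense_hasDistinctAngles (hkn : k + k ≤ n) (W : Gr k n) :
    Dense {L : Gr k n | HasDistinctAngles L W} := fun L => by
  obtain ⟨p, b, h⟩ := exists_isPrincipalPair_cos L W
  obtain ⟨u, hu, L_eq, -⟩ := h.exists_eq_grExp_ofSVD hkn (principalAngle_mem_Icc L W)
  have mem_closure := mem_closure_strictMono_Ioo (monotone_principalAngle L W) Real.pi_div_two_pos
    fun i => ⟨principalAngle_nonneg L W i, principalAngle_le_pi_div_two L W i⟩
  have mapsTo : Set.MapsTo (fun τ => grExp W (ofSVD b u τ))
      {τ | StrictMono τ ∧ ∀ i, τ i ∈ Set.Ioo 0 (Real.pi / 2)} {L | HasDistinctAngles L W} :=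
    fun τ hτ => hasDistinctAngles_grExp_ofSVD hu hτ.1 hτ.2
  have grExp_mem := map_mem_closure (continuous_grExp_ofSVD b hu) mem_closure mapsTo
  rwa [← L_eq] at grExp_mem

theorem isGeneric_hasDistinctAngles (hkn : k + k ≤ n) (hs : 1 ≤ s) (W : Gr k n) :
    IsGeneric fun L : Gr k n => L ∉ schubert W s ∧ HasDistinctAngles L W := by
  obtain ⟨-, w, -⟩ := exists_isPrincipalPair_cos W W
  obtain ⟨F, eval_F⟩ := exists_eval_projEntry_eq_spectrumObstruction (k := k) fun i => (w i : Vec n)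
  have ne_zero_iff : ∀ L : Gr k n, MvPolynomial.eval L.projEntry F ≠ 0 ↔ HasDistinctAngles L W :=
    fun L => by rw [eval_F, spectrumObstruction_projGram_ne_zero_iff]
  refine ⟨F, ?_, fun L hL => ?_⟩
  · simpa only [ne_zero_iff] using dense_hasDistinctAngles hkn W
  · exact ⟨notMem_schubert_of_hasDistinctAngles hs ((ne_zero_iff L).1 hL), (ne_zero_iff L).1 hL⟩

end Generic

end NonlinearEckartYoung

open NonlinearEckartYoung in
theorem theorem4 (k n s : ℕ) (hkn : k + k ≤ n) (hs : 1 ≤ s) (hsk : s ≤ k) (W : Gr k n) :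
    IsGeneric (fun L : Gr k n => L ∉ schubert W s ∧ HasDistinctAngles L W) ∧
    ∀ L : Gr k n, HasDistinctAngles L W →
      ∀ p q : Fin k → Vec n, IsPrincipalVectors L.plane W.plane p q →
        ∃ Em : Gr k n,
          Em.plane = Submodule.span ℝ
            (Set.range fun i : Fin k => if (i : ℕ) < s then q i else p i) ∧
          Em ∈ schubert W s ∧
          (∀ E ∈ schubert W s, E ≠ Em → grassmannDist L Em < grassmannDist L E) ∧
          grassmannDist L Em =
            √(∑ i ∈ Finset.univ.filter (fun i : Fin k => (i : ℕ) < s), principalAngle L W i ^ 2) ∧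
          IsEckartYoungPoint W L s Em := by
  refine ⟨isGeneric_hasDistinctAngles hkn hs W, fun L hL p q hpq => ?_⟩
  obtain ⟨b, c, rfl, rfl, pair⟩ := hpq.exists_isPrincipalPair_cos
  obtain ⟨Em, hEm⟩ := pair.exists_gr_plane_eq_span s
  have mem_Em : ∀ i : Fin k, (i : ℕ) < s → (c i : Vec n) ∈ Em.plane := fun i hi =>
    hEm.ge (Submodule.subset_span ⟨i, if_pos hi⟩)
  exact ⟨Em, hEm, mem_schubert_of_forall_mem hsk mem_Em,
    fun E hE hne => pair.grassmannDist_lt_of_ne hL hEm hE hne,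
    pair.grassmannDist_eq_of_plane_eq_span hEm,
    pair.isEckartYoungPoint_of_plane_eq_span hkn hsk hL hEm⟩
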